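/- Let $p$ be a prime with $p\equiv 1 \pmod 3$, let $|\cdot|_p$ be the $p$-adic absolute value on $\mathbb{Q}_p$, let $\mathcal{E}_p=\{x\in\mathbb{Q}_p: |x-1|_p<p^{-1/(p-1)}\}$, and let $\exp_p$, $\ln_p$ be the $p$-adic exponential and logarithm. **The model.** Let $V$ be the vertex set of the semi-infinite Cayley tree of order $k=3$ with root $x^0$ (every vertex has exactly three direct successors). Let $W_n$ be the set of vertices at distance $n$ from $x^0$, $V_n=W_0\cup\dots\cup W_n$, and $L_n$ the set of edges with both end points in $V_n$. Let $q\in\mathbb{N}$, let $J\in\mathbb{Q}_p$ with $|J|_p<p^{-1/(p-1)}$, and put $\theta=\exp_p(J)$. For a boundary function $\tilde h:V\to\mathbb{Q}_p^q$ with $|\tilde h_x^{(i)}|_p<p^{-1/(p-1)}$ for all $x$ and $i$, let $$\mu^{(n)}_{\tilde h}(\sigma)=\frac{1}{\mathcal{Z}^{(n)}_{\tilde h}}\exp_p\Big(J\sum_{\langle x,y\rangle\in L_n}\delta_{\sigma(x)\sigma(y)}+\sum_{x\in W_n}\tilde h_x^{(\sigma(x))}\Big),\qquad \sigma:V_n\to\{1,\dots,q\},$$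 where $\mathcal{Z}^{(n)}_{\tilde h}$ is the normalizing sum, which has to be nonzero. If these distributions are compatible (summing $\mu^{(n+1)}_{\tilde h}$ over the spins on $W_{n+1}$ gives $\mu^{(n)}_{\tilde h}$, for all $n\ge 0$), then a finitely additive $\mathbb{Q}_p$-valued measure $\mu$ on the algebra of cylinder subsets of $\{1,\dots,q\}^V$ with $\mu(\{\sigma|_{V_n}=\sigma_n\})=\mu_{\tilde h}^{(n)}(\sigma_n)$ for all $n$ and $\sigma_n$ is called the $p$-adic Gibbs measure associated with $\tilde h$. It is called $H_m$-periodic if $\tilde h$ is $m$-periodic, that is, if there are $\tilde h^{(0)},\dots,\tilde h^{(m-1)}\in\mathbb{Q}_p^q$ with $\tilde h(x)=\tilde h^{(j)}$ whenever $d(x,x^0)\equiv j\pmod m$. **Theorem.** Suppose that $0<|\theta-1|_p<|q|_p<1$ and write $q=q^*/|q|_p$ with $q^*\in\mathbb{N}$, $p\nmid q^*$. Let $m\ge1$. Let $\alpha,\beta\subset\{1,\dots,q-1\}$ be disjoint with $|\alpha|+|\beta|=q-1$, $\alpha\neq\emptyset$ and $$|\alpha|\notin\Big\{\frac{1}{|q|_p},\frac{2}{|q|_p},\dots,\frac{q^*-1}{|q|_p}\Big\},$$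 and let $\mathbf{e}_\alpha,\mathbf{e}_\beta\in\mathbb{Q}_p^{q-1}$ be the indicator vectors of $\alpha$ and $\beta$. Consider the Potts–Bethe mapping $$G_{\theta,\alpha,q,3}(z)=\left(\frac{(\theta+|\alpha|-1)z+q-|\alpha|}{|\alpha|z+\theta+q-|\alpha|-1}\right)^3$$ on the set of all $z\in\mathbb{Q}_p$ at which the denominator does not vanish. Call a family $\{z^{(j)}\}_{j=0}^{m-1}$ in this set an $m$-cycle if $z^{(j)}=G_{\theta,\alpha,q,3}(z^{(j+1)})$ for $0\le j\le m-1$, where $z^{(m)}:=z^{(0)}$ (the $z^{(j)}$ need not be distinct). Then: 1. There is an $m$-cycle of $G_{\theta,\alpha,q,3}$ consisting of $m$ distinct points, none of which equals $1$. 2. Every $m$-cycle $\{z^{(j)}\}_{j=0}^{m-1}$ of $G_{\theta,\alpha,q,3}$ is contained in $\mathcal{E}_p$. For every such $m$-cycle and every $h\in\mathcal{E}_p$, put $\mathbf{z}^{(j)}=z^{(j)}\mathbf{e}_\alpha+\mathbf{e}_\beta$ and $$\tilde{\mathbf{h}}^{(j)}=\big(\ln_p(hz^{(j)}_1),\dots,\ln_p(hz^{(j)}_{q-1}),\ln_p(h)\big),\qquad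 0\le j\le m-1.$$ Then there exists a unique $p$-adic Gibbs measure associated with the $m$-periodic boundary function whose values are $\tilde{\mathbf{h}}^{(0)},\dots,\tilde{\mathbf{h}}^{(m-1)}$; it is $H_m$-periodic. -/

import Mathlib

namespace PadicPotts

noncomputable section

/-! ### `p`-adic exponential and logarithm -/

/-- The radius `p ^ (-1/(p-1))` of the disc of convergence of the `p`-adic exponential. -/
def expRadius (p : ℕ) : ℝ := (p : ℝ) ^ (-(1 : ℝ) / ((p : ℝ) - 1))

/-- The set `𝓔_p = {x ∈ ℚ_p : |x - 1|_p < p ^ (-1/(p-1))}`. -/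
def expDomain (p : ℕ) [Fact p.Prime] : Set ℚ_[p] := {x | ‖x - 1‖ < expRadius p}

/-- The `p`-adic exponential `∑ xⁿ / n!`, meaningful for `|x|_p < p ^ (-1/(p-1))`. -/
def padicExp {p : ℕ} [Fact p.Prime] (x : ℚ_[p]) : ℚ_[p] := NormedSpace.exp x

/-- The `p`-adic logarithm `∑_{n ≥ 1} (-1)ⁿ⁺¹ (x - 1)ⁿ / n`, meaningful for `|x - 1|_p < 1`. -/
def padicLog {p : ℕ} [Fact p.Prime] (x : ℚ_[p]) : ℚ_[p] :=
  ∑' n : ℕ, (-1) ^ n * (x - 1) ^ (n + 1) / ((n : ℚ_[p]) + 1)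

/-! ### The semi-infinite Cayley tree of order `k`

A vertex is a finite word `(i₁, …, iₙ)` in `k` letters; the root is the empty word, the distance of
a vertex from the root is its length, and the direct successors of `x` are the words `(x, i)`. -/

/-- The vertices of the semi-infinite Cayley tree of order `k`. -/
abbrev Vertex (k : ℕ) : Type := List (Fin k)

/-- The set `S(x)` of direct successors of the vertex `x`. -/
def successors {k : ℕ} (x : Vertex k) : Finset (Vertex k) :=
  Finset.univ.image fun i : Fin k => x ++ [i]

/-- The sphere `W_n` of the vertices at distance `n` from the root. -/
def level (k n : ℕ) : Finset (Vertex k) := (List.finite_length_eq (Fin k) n).toFinset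

/-- The ball `V_n = W_0 ∪ ⋯ ∪ W_n`. -/
def ball (k n : ℕ) : Finset (Vertex k) := (List.finite_length_le (Fin k) n).toFinset

theorem mem_level {k n : ℕ} {x : Vertex k} : x ∈ level k n ↔ x.length = n := by
  simp [level]

theorem mem_ball {k n : ℕ} {x : Vertex k} : x ∈ ball k n ↔ x.length ≤ n := by
  simp [ball]

theorem mem_level_of_mem_ball_succ {k n : ℕ} {x : Vertex k} (hx : x ∈ ball k (n + 1))
    (hx' : x ∉ ball k n) : x ∈ level k (n + 1) := by
  rw [mem_ball] at hx hx'
  rw [mem_level]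
  omega

/-- The edges `L_n` of the tree with both end points in `V_n`. Each edge occurs exactly once, as the
pair `(x, y)` whose second entry `y` is a direct successor of the first. -/
def edges (k n : ℕ) : Finset (ball k n × ball k n) :=
  Finset.univ.filter fun e => (e.2 : Vertex k) ∈ successors (e.1 : Vertex k)

/-! ### The `q`-state Potts model

The spin values are the elements of `Fin q`; the last one, of value `q - 1`, plays the role of the
spin `q`, and `Fin (q - 1)` that of the index set `{1, …, q - 1}`. -/

/-- Configurations `V → {1, …, q}`. -/
abbrev Config (k q : ℕ) : Type := Vertex k → Fin q

/-- Finite volume configurations `V_n → {1, …, q}`. -/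
abbrev VolConfig (k q n : ℕ) : Type := ball k n → Fin q

/-- Boundary configurations `W_n → {1, …, q}`. -/
abbrev LevelConfig (k q n : ℕ) : Type := level k n → Fin q

/-- Boundary functions `V → ℚ_p ^ q`. -/
abbrev BoundaryFunction (p k q : ℕ) [Fact p.Prime] : Type := Vertex k → Fin q → ℚ_[p]

/-- The concatenation of a configuration on `V_n` with a configuration on `W_{n+1}`. -/
def concat {k q n : ℕ} (σ : VolConfig k q n) (τ : LevelConfig k q (n + 1)) :
    VolConfig k q (n + 1) := fun v =>
  if h : (v : Vertex k) ∈ ball k n then σ ⟨v, h⟩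
  else τ ⟨v, mem_level_of_mem_ball_succ v.2 h⟩

section Gibbs

variable {p : ℕ} [Fact p.Prime] {k q : ℕ}

/-- The Hamiltonian `H_n(σ) = J ∑_{⟨x, y⟩ ∈ L_n} δ_{σ(x) σ(y)}`. -/
def hamiltonian (J : ℚ_[p]) {n : ℕ} (σ : VolConfig k q n) : ℚ_[p] :=
  J * ∑ e ∈ edges k n, if σ e.1 = σ e.2 then (1 : ℚ_[p]) else 0

/-- The weight `exp_p (H_n(σ) + ∑_{x ∈ W_n} h_x^{(σ(x))})`. -/
def weight (J : ℚ_[p]) (h : BoundaryFunction p k q) {n : ℕ} (σ : VolConfig k q n) : ℚ_[p] :=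
  padicExp (hamiltonian J σ +
    ∑ x ∈ Finset.univ.filter fun x : ball k n => (x : Vertex k) ∈ level k n, h x (σ x))

/-- The partition function. -/
def partitionFunction (J : ℚ_[p]) (h : BoundaryFunction p k q) (n : ℕ) : ℚ_[p] :=
  ∑ σ : VolConfig k q n, weight J h σ

/-- The finite volume distribution `μ_h^{(n)}`. -/
def finiteGibbs (J : ℚ_[p]) (h : BoundaryFunction p k q) {n : ℕ} (σ : VolConfig k q n) : ℚ_[p] :=
  weight J h σ / partitionFunction J h n

/-- The compatibility of the distributions `μ_h^{(n)}`. -/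
def Compatible (J : ℚ_[p]) (h : BoundaryFunction p k q) : Prop :=
  ∀ (n : ℕ) (σ : VolConfig k q n),
    ∑ τ : LevelConfig k q (n + 1), finiteGibbs J h (concat σ τ) = finiteGibbs J h σ

variable (p k q) in
/-- `p`-adic (finitely additive, `ℚ_p`-valued) measures on the algebra of the cylinder subsets of
the configuration space. -/
abbrev PadicMeasure : Type :=
  MeasureTheory.AddContent ℚ_[p]
    (MeasureTheory.measurableCylinders fun _ : Vertex k => Fin q)

/-- `μ` is the `p`-adic Gibbs measure of the Potts model with coupling constant `J` associated with
the boundary function `h`: the values of `h` lie in the disc of convergence of `exp_p`, the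
distributions `μ_h^{(n)}` are well defined and compatible, and `μ` extends them. -/
structure IsGibbsMeasure (J : ℚ_[p]) (h : BoundaryFunction p k q) (μ : PadicMeasure p k q) :
    Prop where
  norm_lt : ∀ x i, ‖h x i‖ < expRadius p
  partition_ne_zero : ∀ n, partitionFunction J h n ≠ 0
  compatible : Compatible J h
  extends_finite : ∀ (n : ℕ) (σ : VolConfig k q n),
    μ (MeasureTheory.cylinder (ball k n) {σ}) = finiteGibbs J h σ

/-- The boundary function `h` is `m`-periodic with values `g 0, …, g (m - 1)`. -/
def IsPeriodicBoundary {m : ℕ} (g : Fin m → Fin q → ℚ_[p]) (h : BoundaryFunction p k q) : Prop :=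
  ∀ (x : Vertex k) (j : Fin m), x.length ≡ j [MOD m] → h x = g j

end Gibbs

/-! ### The Potts–Bethe mapping -/

section PottsBethe

variable {p : ℕ} [Fact p.Prime]

/-- The denominator `a z + θ + q - a - 1` of the Potts–Bethe mapping, where `a = |α|`. -/
def pottsBetheDen (θ : ℚ_[p]) (a q : ℕ) (z : ℚ_[p]) : ℚ_[p] :=
  (a : ℚ_[p]) * z + θ + (q : ℚ_[p]) - (a : ℚ_[p]) - 1

/-- The Potts–Bethe mapping `G_{θ,α,q,k}`, where `a = |α|`; its domain is the set of the `z` at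
which the denominator does not vanish. -/
def pottsBethe (θ : ℚ_[p]) (a q k : ℕ) (z : ℚ_[p]) : ℚ_[p] :=
  (((θ + (a : ℚ_[p]) - 1) * z + (q : ℚ_[p]) - (a : ℚ_[p])) / pottsBetheDen θ a q z) ^ k

/-- `z^{(j)} = G_{θ,α,q,k} (z^{(j+1)})` for `0 ≤ j < m`, where `z^{(m)} = z^{(0)}` (the addition in
`Fin m` wraps around). The `z^{(j)}` need not be distinct. -/
def IsPottsBetheCycle (θ : ℚ_[p]) (a q k : ℕ) {m : ℕ} [NeZero m] (z : Fin m → ℚ_[p]) : Prop :=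
  ∀ j, pottsBetheDen θ a q (z j) ≠ 0 ∧ z j = pottsBethe θ a q k (z (j + 1))

/-- The vector `e_α = ∑_{j ∈ α} e_j` of `ℚ_p ^ (q-1)`. -/
def indicatorVec {q : ℕ} (α : Finset (Fin (q - 1))) : Fin (q - 1) → ℚ_[p] :=
  ∑ j ∈ α, Pi.single j 1

/-- The vector `(ln_p (h z₁), …, ln_p (h z_{q-1}), ln_p h)` of `ℚ_p ^ q`. -/
def logVec {q : ℕ} (h : ℚ_[p]) (z : Fin (q - 1) → ℚ_[p]) : Fin q → ℚ_[p] := fun i =>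
  if hi : (i : ℕ) < q - 1 then padicLog (h * z ⟨i, hi⟩) else padicLog h

end PottsBethe

end

end PadicPotts

open PadicPotts

open Filter Topology

namespace PadicPotts

noncomputable section

/-! ### The exponential and the logarithm on the open unit disc, for odd `p`. -/

section PadicExpLog

variable {p : ℕ} [Fact p.Prime]

/-! Put u = z - 1, t = θ - 1 and a = |α|. The Potts–Bethe mapping becomes u ↦ (1 + tu/(au + q +
t))^3 - 1, and the condition on |α| amounts to |t| < |q| < |a| (`norm_lt_norm_of_not_multiple`).
Since p > 3, cubing preserves distances near 1. Hence the disc |u| < |q/a| is contracted towards the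
fixed point 0 with ratio |t/q|, and every u with |u| > |q/a| is sent to |u| = |t/a|, inside that
disc. A cycle is therefore constant at z = 1 or lies on the circle |u| = |q/a| < 1
(`cycle_dichotomy`), which gives the inclusion in 𝓔_p.

Cycles on the circle come from symbolic dynamics. As p ≡ 1 (mod 3), there are two nontrivial cube
roots of unity modulo p. Each gives a contracting inverse branch, and the contraction principle
produces a cycle with any prescribed itinerary (`exists_cycle`). An itinerary that uses one root
exactly once and the other root everywhere else forces the m points to be distinct.

For the Gibbs measure, exp(log x) = x makes the boundary weight of a spin equal to hz on α and to h
elsewhere. Summing out W_{n+1} factorises over its vertices, and the cycle equation says exactly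
that the result is the previous weight up to a constant (`gibbs_of_backward_orbit`). It remains to
see that the partition function at the root, h(au + q), is nonzero: if au + q vanished at a point of
a cycle, the cycle would leave the circle two steps later (`cycle_add_ne_zero`). A compatible family
then determines exactly one finitely additive measure, because each cylinder set is a finite
disjoint union of cylinders over single configurations. -/

theorem norm_le_inv_of_norm_lt_one {x : ℚ_[p]} (hx : ‖x‖ < 1) : ‖x‖ ≤ (p : ℝ)⁻¹ := by
  have := (Padic.norm_lt_pow_iff_norm_le_pow_sub_one x 0).1 (by simpa using hx)
  simpa using this

/-- Norms in ℚ_p jump from 1 to 1/p, and 1/p < p^(-1/(p-1)) < 1 for p > 2. All later estimates can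
thus use the open unit disc. -/
theorem norm_lt_expRadius_iff (hp : 2 < p) {x : ℚ_[p]} : ‖x‖ < expRadius p ↔ ‖x‖ < 1 := by
  have h1 : (1 : ℝ) < p := by exact_mod_cast (by omega : 1 < p)
  have h2 : (2 : ℝ) < p := by exact_mod_cast hp
  have hpos : (0 : ℝ) < (p : ℝ) - 1 := by linarith
  constructor
  · intro h
    refine h.trans (Real.rpow_lt_one_of_one_lt_of_neg h1 ?_)
    exact div_neg_of_neg_of_pos (by norm_num) hpos
  · intro h
    refine (norm_le_inv_of_norm_lt_one h).trans_lt ?_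
    rw [← Real.rpow_neg_one]
    refine Real.rpow_lt_rpow_of_exponent_lt h1 ?_
    rw [lt_div_iff₀ hpos]
    linarith

theorem mem_expDomain_iff (hp : 2 < p) {x : ℚ_[p]} : x ∈ expDomain p ↔ ‖x - 1‖ < 1 :=
  norm_lt_expRadius_iff hp

theorem norm_eq_one_of_norm_sub_one_lt {x : ℚ_[p]} (hx : ‖x - 1‖ < 1) : ‖x‖ = 1 := by
  have := Padic.norm_eq_of_norm_sub_lt_right (z1 := x) (z2 := 1) (by simpa using hx)
  simpa using this

theorem norm_mul_sub_one_lt {x y : ℚ_[p]} (hx : ‖x - 1‖ < 1) (hy : ‖y - 1‖ < 1) :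
    ‖x * y - 1‖ < 1 := by
  have h : x * y - 1 = x * (y - 1) + (x - 1) := by ring
  rw [h]
  refine (Padic.nonarchimedean _ _).trans_lt (max_lt ?_ hx)
  rwa [norm_mul, norm_eq_one_of_norm_sub_one_lt hx, one_mul]

theorem inv_norm_natCast_le {n : ℕ} (hn : n ≠ 0) : ‖(n : ℚ_[p])‖⁻¹ ≤ n := by
  have hn' : (n : ℚ_[p]) ≠ 0 := by exact_mod_cast hn
  rw [Padic.norm_eq_zpow_neg_valuation hn', Padic.valuation_natCast, zpow_neg, inv_inv,
    zpow_natCast]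
  exact_mod_cast Nat.le_of_dvd (Nat.pos_of_ne_zero hn) pow_padicValNat_dvd

/-- Legendre's formula bounds (p - 1) v_p(n!) by n, and p - 1 ≥ 2. -/
theorem inv_norm_factorial_sq_le (hp : 2 < p) (n : ℕ) :
    ‖((n.factorial : ℕ) : ℚ_[p])‖⁻¹ ^ 2 ≤ (p : ℝ) ^ n := by
  have hn' : ((n.factorial : ℕ) : ℚ_[p]) ≠ 0 := by exact_mod_cast n.factorial_ne_zero
  rw [Padic.norm_eq_zpow_neg_valuation hn', Padic.valuation_natCast, zpow_neg, inv_inv,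
    zpow_natCast, ← pow_mul]
  refine pow_le_pow_right₀ (by exact_mod_cast (by omega : 1 ≤ p)) ?_
  have h := sub_one_mul_padicValNat_factorial (p := p) n
  have h2 : 2 ≤ p - 1 := by omega
  have := Nat.mul_le_mul_right (padicValNat p n.factorial) h2
  omega

/-- The `p`-adic exponential series converges on the open unit disc of `ℚ_p` if `p` is odd. -/
theorem mem_eball_expSeries_radius (hp : 2 < p) {x : ℚ_[p]} (hx : ‖x‖ < 1) :
    x ∈ Metric.eball (0 : ℚ_[p]) (NormedSpace.expSeries ℚ_[p] ℚ_[p]).radius := by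
  have h1 : (1 : ℝ) < p := by exact_mod_cast (by omega : 1 < p)
  -- The radius p^(-1/2) is covered by the factorial estimate and still exceeds 1/p, the largest
  -- norm below 1.
  set r : NNReal := ⟨(Real.sqrt p)⁻¹, by positivity⟩ with hr
  have hle : (r : ENNReal) ≤ (NormedSpace.expSeries ℚ_[p] ℚ_[p]).radius := by
    refine FormalMultilinearSeries.le_radius_of_bound _ 1 fun n => ?_
    rw [NormedSpace.expSeries_eq_ofScalars, FormalMultilinearSeries.ofScalars_norm]
    rw [← sq_le_one_iff₀ (by positivity), mul_pow, norm_inv, hr]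
    have h3 : ((Real.sqrt p)⁻¹ ^ n) ^ 2 = ((p : ℝ) ^ n)⁻¹ := by
      rw [← pow_mul, mul_comm n 2, pow_mul, inv_pow, Real.sq_sqrt (by positivity), inv_pow]
    change _ * ((Real.sqrt p)⁻¹ ^ n) ^ 2 ≤ 1
    rw [h3, ← div_eq_mul_inv, div_le_one (by positivity)]
    exact inv_norm_factorial_sq_le hp n
  refine Metric.eball_subset_eball hle ?_
  rw [mem_eball_zero_iff, ← ofReal_norm, ENNReal.ofReal_lt_coe_iff]
  · refine (norm_le_inv_of_norm_lt_one hx).trans_lt ?_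
    rw [hr]
    change (p : ℝ)⁻¹ < (Real.sqrt p)⁻¹
    refine inv_strictAnti₀ (by positivity) ?_
    rw [Real.sqrt_lt' (by positivity)]
    nlinarith
  · positivity

theorem padicExp_zero : padicExp (0 : ℚ_[p]) = 1 := NormedSpace.exp_zero

theorem padicExp_add (hp : 2 < p) {x y : ℚ_[p]} (hx : ‖x‖ < 1) (hy : ‖y‖ < 1) :
    padicExp (x + y) = padicExp x * padicExp y :=
  NormedSpace.exp_add_of_mem_ball (mem_eball_expSeries_radius hp hx)
    (mem_eball_expSeries_radius hp hy)

theorem padicExp_sum (hp : 2 < p) {ι : Type*} (s : Finset ι) (f : ι → ℚ_[p])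
    (hf : ∀ i ∈ s, ‖f i‖ < 1) : padicExp (∑ i ∈ s, f i) = ∏ i ∈ s, padicExp (f i) := by
  classical
  induction s using Finset.induction_on with
  | empty => simp [padicExp_zero]
  | insert a s ha ih =>
    have h2 : ‖∑ i ∈ s, f i‖ < 1 := by
      refine lt_of_le_of_lt (IsUltrametricDist.norm_sum_le_of_forall_le_of_nonneg
        (C := (p : ℝ)⁻¹) (by positivity) fun i hi =>
        norm_le_inv_of_norm_lt_one (hf i (Finset.mem_insert_of_mem hi))) ?_
      exact inv_lt_one_of_one_lt₀ (by exact_mod_cast (by omega : 1 < p))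
    rw [Finset.sum_insert ha, Finset.prod_insert ha,
      padicExp_add hp (hf a (Finset.mem_insert_self _ _)) h2,
      ih fun i hi => hf i (Finset.mem_insert_of_mem hi)]

theorem padicExp_natCast_mul (hp : 2 < p) {x : ℚ_[p]} (hx : ‖x‖ < 1) (n : ℕ) :
    padicExp ((n : ℚ_[p]) * x) = padicExp x ^ n := by
  have := padicExp_sum hp (Finset.range n) (fun _ => x) fun _ _ => hx
  simpa using this

theorem norm_padicExp_sub_one_lt (hp : 2 < p) {x : ℚ_[p]} (hx : ‖x‖ < 1) :
    ‖padicExp x - 1‖ < 1 := by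
  have h1 : (1 : ℝ) < p := by exact_mod_cast (by omega : 1 < p)
  have hs := NormedSpace.expSeries_div_hasSum_exp_of_mem_ball (𝕂 := ℚ_[p]) x (mem_eball_expSeries_radius hp hx)
  have hs' := (hasSum_nat_add_iff' (G := ℚ_[p]) 1).2 hs
  have he : padicExp x - 1 = ∑' n : ℕ, x ^ (n + 1) / ((n + 1).factorial : ℚ_[p]) := by
    rw [hs'.tsum_eq]; simp [padicExp]
  rw [he]
  refine lt_of_le_of_lt (IsUltrametricDist.norm_tsum_le_of_forall_le_of_nonneg
    (C := (p : ℝ)⁻¹) (by positivity) fun n => norm_le_inv_of_norm_lt_one ?_)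
    (inv_lt_one_of_one_lt₀ h1)
  rw [← sq_lt_one_iff₀ (norm_nonneg _), norm_div, norm_pow, div_eq_mul_inv, mul_pow]
  calc (‖x‖ ^ (n + 1)) ^ 2 * ‖((n + 1).factorial : ℚ_[p])‖⁻¹ ^ 2
      ≤ (((p : ℝ)⁻¹) ^ (n + 1)) ^ 2 * (p : ℝ) ^ (n + 1) := by
        gcongr
        · exact norm_le_inv_of_norm_lt_one hx
        · exact inv_norm_factorial_sq_le hp _
    _ = (((p : ℝ)⁻¹) ^ (n + 1)) := by
        rw [sq, mul_assoc, ← mul_pow, inv_mul_cancel₀ (by positivity), one_pow, mul_one]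
    _ < 1 := pow_lt_one₀ (by positivity) (inv_lt_one_of_one_lt₀ h1) (by omega)

theorem norm_logTerm_le {u : ℚ_[p]} (hu : ‖u‖ < 1) (k : ℕ) :
    ‖u ^ (k + 1) / ((k : ℚ_[p]) + 1)‖ ≤ (2 / (p : ℝ)) ^ k * ‖u‖ := by
  have h : ‖(k : ℚ_[p]) + 1‖⁻¹ ≤ (2 : ℝ) ^ k := by
    have h1 := inv_norm_natCast_le (p := p) (n := k + 1) (by omega)
    push_cast at h1
    refine h1.trans ?_
    exact_mod_cast (Nat.lt_two_pow_self (n := k))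
  calc ‖u ^ (k + 1) / ((k : ℚ_[p]) + 1)‖ = ‖u‖ ^ k * ‖(k : ℚ_[p]) + 1‖⁻¹ * ‖u‖ := by
        rw [norm_div, norm_pow, div_eq_mul_inv]; ring
    _ ≤ ((p : ℝ)⁻¹) ^ k * 2 ^ k * ‖u‖ := by
        gcongr
        exact norm_le_inv_of_norm_lt_one hu
    _ = (2 / (p : ℝ)) ^ k * ‖u‖ := by rw [← mul_pow]; congr 2; ring

theorem norm_padicLog_lt_one (hp : 2 < p) {x : ℚ_[p]} (hx : ‖x - 1‖ < 1) :
    ‖padicLog x‖ < 1 := by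
  refine lt_of_le_of_lt (IsUltrametricDist.norm_tsum_le_of_forall_le_of_nonneg
    (C := ‖x - 1‖) (norm_nonneg _) fun n => ?_) hx
  rw [mul_div_assoc, norm_mul, norm_pow, norm_neg, norm_one, one_pow, one_mul]
  refine (norm_logTerm_le hx n).trans (mul_le_of_le_one_left (norm_nonneg _) ?_)
  refine pow_le_one₀ (by positivity) ?_
  rw [div_le_one (by positivity)]
  exact_mod_cast hp.le

/-- Binomial expansion at 1, with C(n, k+1)/n = C(n-1, k)/(k+1). As n tends to 0 in ℚ_p, the
coefficients C(n-1, k) tend to (-1)^k and the logarithm series appears. -/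
theorem pow_sub_one_div_eq_sum (x : ℚ_[p]) {n : ℕ} (hn : n ≠ 0) :
    (x ^ n - 1) / n =
      ∑ k ∈ Finset.range n, ((n - 1).choose k : ℚ_[p]) * ((x - 1) ^ (k + 1) / ((k : ℚ_[p]) + 1)) := by
  have hn' : (n : ℚ_[p]) ≠ 0 := by exact_mod_cast hn
  have hx : x ^ n = ((x - 1) + 1) ^ n := by ring
  rw [hx, add_pow, Finset.sum_range_succ']
  simp only [one_pow, mul_one, pow_zero, Nat.choose_zero_right, Nat.cast_one, add_sub_cancel_right]
  rw [Finset.sum_div]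
  refine Finset.sum_congr rfl fun k _ => ?_
  have hk : ((k : ℚ_[p]) + 1) ≠ 0 := by exact_mod_cast k.succ_ne_zero
  obtain ⟨l, rfl⟩ := Nat.exists_eq_succ_of_ne_zero hn
  have h : ((l : ℚ_[p]) + 1) * l.choose k = (l + 1).choose (k + 1) * ((k : ℚ_[p]) + 1) := by
    exact_mod_cast Nat.add_one_mul_choose_eq l k
  simp only [Nat.succ_eq_add_one, Nat.add_sub_cancel]
  push_cast at hn' ⊢
  field_simp
  linear_combination (x - 1) ^ (k + 1) * (-h)

/-- In the binomial expansion the term k = 0 is x - 1. The others are smaller by a factor 2/p at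
least, the binomial coefficients being p-adic integers. -/
theorem norm_pow_sub_one (hp : 2 < p) {x : ℚ_[p]} (hx : ‖x - 1‖ < 1) {n : ℕ} (hn : n ≠ 0) :
    ‖(x ^ n - 1) / n‖ = ‖x - 1‖ := by
  rcases eq_or_ne (x - 1) 0 with h0 | h0
  · have : x = 1 := sub_eq_zero.1 h0
    simp [this]
  have h2p : 2 / (p : ℝ) < 1 := by
    rw [div_lt_one (by positivity)]
    exact_mod_cast hp
  obtain ⟨l, rfl⟩ := Nat.exists_eq_succ_of_ne_zero hn
  refine Padic.norm_eq_of_norm_sub_lt_right ?_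
  rw [pow_sub_one_div_eq_sum x hn, Finset.sum_range_succ']
  simp only [Nat.choose_zero_right, Nat.cast_one, one_mul, Nat.cast_zero, zero_add, pow_one, div_one,
    add_sub_cancel_right]
  refine lt_of_le_of_lt (IsUltrametricDist.norm_sum_le_of_forall_le_of_nonneg
    (C := 2 / (p : ℝ) * ‖x - 1‖) (by positivity) fun k _ => ?_)
    (mul_lt_of_lt_one_left (norm_pos_iff.2 h0) h2p)
  rw [norm_mul]
  refine (mul_le_of_le_one_left (norm_nonneg _) ?_).trans ((norm_logTerm_le hx (k + 1)).trans ?_)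
  · exact_mod_cast Padic.norm_int_le_one ((l.succ - 1).choose (k + 1) : ℤ)
  · gcongr
    exact pow_le_of_le_one (by positivity) h2p.le (by omega)

theorem tendsto_natCast_pow_prime : Tendsto (fun n : ℕ => ((p ^ n : ℕ) : ℚ_[p])) atTop (𝓝 0) := by
  have := tendsto_pow_atTop_nhds_zero_of_norm_lt_one (Padic.norm_p_lt_one (p := p))
  simpa using this

/-- The limit is C(-1, k), reached through Pascal's rule by induction on k. -/
theorem tendsto_choose_pow_prime_sub_one (k : ℕ) :
    Tendsto (fun n : ℕ => ((p ^ n - 1).choose k : ℚ_[p])) atTop (𝓝 ((-1) ^ k)) := by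
  induction k with
  | zero => simp
  | succ k ih =>
    have hk : ((k : ℚ_[p]) + 1) ≠ 0 := by exact_mod_cast k.succ_ne_zero
    have h : ∀ n : ℕ, ((p ^ n - 1).choose (k + 1) : ℚ_[p]) =
        ((p ^ n : ℕ) : ℚ_[p]) * ((p ^ n - 1).choose k : ℚ_[p]) / ((k : ℚ_[p]) + 1) -
          ((p ^ n - 1).choose k : ℚ_[p]) := by
      intro n
      obtain ⟨l, hl⟩ := Nat.exists_eq_succ_of_ne_zero (pow_ne_zero n (NeZero.ne p))
      rw [hl, Nat.succ_eq_add_one, Nat.add_sub_cancel]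
      have h1 : ((l : ℚ_[p]) + 1) * l.choose k = (l + 1).choose (k + 1) * ((k : ℚ_[p]) + 1) := by
        exact_mod_cast Nat.add_one_mul_choose_eq l k
      have h2 : ((l + 1).choose (k + 1) : ℚ_[p]) = l.choose k + l.choose (k + 1) := by
        exact_mod_cast Nat.choose_succ_succ l k
      push_cast
      field_simp
      linear_combination -h1 - ((k : ℚ_[p]) + 1) * h2
    simp only [h]
    have := ((tendsto_natCast_pow_prime (p := p)).mul ih).div_const ((k : ℚ_[p]) + 1) |>.sub ih
    convert this using 2
    ring

theorem tendsto_pow_sub_one_div_padicLog (hp : 2 < p) {x : ℚ_[p]} (hx : ‖x - 1‖ < 1) :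
    Tendsto (fun n : ℕ => (x ^ p ^ n - 1) / ((p ^ n : ℕ) : ℚ_[p])) atTop (𝓝 (padicLog x)) := by
  have h2p : 2 / (p : ℝ) < 1 := by
    rw [div_lt_one (by positivity)]
    exact_mod_cast hp
  have h : ∀ n : ℕ, (x ^ p ^ n - 1) / ((p ^ n : ℕ) : ℚ_[p]) =
      ∑' k : ℕ, ((p ^ n - 1).choose k : ℚ_[p]) * ((x - 1) ^ (k + 1) / ((k : ℚ_[p]) + 1)) := by
    intro n
    have hn : p ^ n ≠ 0 := pow_ne_zero n (NeZero.ne p)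
    rw [pow_sub_one_div_eq_sum x hn, tsum_eq_sum]
    intro k hk
    rw [Nat.choose_eq_zero_of_lt, Nat.cast_zero, zero_mul]
    rw [Finset.mem_range] at hk
    omega
  simp only [h]
  refine tendsto_tsum_of_dominated_convergence (bound := fun k => (2 / (p : ℝ)) ^ k * ‖x - 1‖)
    ((summable_geometric_of_lt_one (by positivity) h2p).mul_right _) (fun k => ?_)
    (Eventually.of_forall fun n k => ?_)
  · simp only [mul_div_assoc]
    exact (tendsto_choose_pow_prime_sub_one k).mul_const _
  · rw [norm_mul]
    refine (mul_le_of_le_one_left (norm_nonneg _) ?_).trans (norm_logTerm_le hx k)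
    exact_mod_cast Padic.norm_int_le_one ((p ^ n - 1).choose k : ℤ)

/-- The quotient is x times the slope of exp between 0 and p^n x, and exp has derivative 1 at 0. -/
theorem tendsto_padicExp_pow_sub_one_div (hp : 2 < p) {x : ℚ_[p]} (hx : ‖x‖ < 1) :
    Tendsto (fun n : ℕ => (padicExp x ^ p ^ n - 1) / ((p ^ n : ℕ) : ℚ_[p])) atTop (𝓝 x) := by
  rcases eq_or_ne x 0 with rfl | h0
  · simp [padicExp_zero]
  have hd : HasDerivAt (NormedSpace.exp : ℚ_[p] → ℚ_[p]) 1 0 := by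
    have := (hasStrictDerivAt_exp_of_mem_ball (𝕂 := ℚ_[p]) (x := 0)
      (mem_eball_expSeries_radius hp (by simp))).hasDerivAt
    simpa using this
  have ht : Tendsto (fun n : ℕ => ((p ^ n : ℕ) : ℚ_[p]) * x) atTop (𝓝[≠] 0) := by
    rw [tendsto_nhdsWithin_iff]
    refine ⟨by simpa using (tendsto_natCast_pow_prime (p := p)).mul_const x,
      Eventually.of_forall fun n => ?_⟩
    exact mul_ne_zero (by exact_mod_cast pow_ne_zero n (NeZero.ne p)) h0
  have := ((hasDerivAt_iff_tendsto_slope.1 hd).comp ht).mul_const x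
  rw [one_mul] at this
  refine this.congr fun n => ?_
  have hn : ((p ^ n : ℕ) : ℚ_[p]) ≠ 0 := by exact_mod_cast pow_ne_zero n (NeZero.ne p)
  have he := padicExp_natCast_mul hp hx (p ^ n)
  rw [← he, Function.comp_apply, slope_def_field, sub_zero, NormedSpace.exp_zero, padicExp]
  field_simp

/-- No composition of power series is needed. With w = exp(log x), the quotients (w^(p^n) - 1)/p^n
and (x^(p^n) - 1)/p^n have the same limit log x, while the norm of their difference is ‖w/x - 1‖ for
every n. So w = x. -/
theorem padicExp_padicLog (hp : 2 < p) {x : ℚ_[p]} (hx : ‖x - 1‖ < 1) :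
    padicExp (padicLog x) = x := by
  have hL := norm_padicLog_lt_one hp hx
  have hw := norm_padicExp_sub_one_lt hp hL
  set w := padicExp (padicLog x) with hwdef
  have hx1 := norm_eq_one_of_norm_sub_one_lt hx
  have hx0 : x ≠ 0 := norm_ne_zero_iff.1 (by rw [hx1]; exact one_ne_zero)
  have hwx : ‖w / x - 1‖ < 1 := by
    rw [div_sub_one hx0, norm_div, hx1, div_one]
    have : w - x = (w - 1) + (1 - x) := by ring
    rw [this]
    exact (Padic.nonarchimedean _ _).trans_lt (max_lt hw (by rwa [norm_sub_rev]))
  have ht := ((tendsto_padicExp_pow_sub_one_div hp hL).sub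
    (tendsto_pow_sub_one_div_padicLog hp hx)).norm
  rw [sub_self, norm_zero] at ht
  have hc : ∀ n : ℕ, ‖(w ^ p ^ n - 1) / ((p ^ n : ℕ) : ℚ_[p]) -
      (x ^ p ^ n - 1) / ((p ^ n : ℕ) : ℚ_[p])‖ = ‖w / x - 1‖ := by
    intro n
    have h1 : ‖x ^ p ^ n‖ = 1 := by rw [norm_pow, hx1, one_pow]
    rw [← norm_pow_sub_one hp hwx (pow_ne_zero n (NeZero.ne p)), div_pow,
      ← one_mul ‖((w ^ p ^ n / x ^ p ^ n - 1) / ((p ^ n : ℕ) : ℚ_[p]))‖, ← h1, ← norm_mul]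
    congr 1
    have hn : ((p ^ n : ℕ) : ℚ_[p]) ≠ 0 := by exact_mod_cast pow_ne_zero n (NeZero.ne p)
    field_simp
    ring
  simp only [← hwdef, hc] at ht
  have h0 := tendsto_nhds_unique ht tendsto_const_nhds
  have : w / x = 1 := sub_eq_zero.1 (norm_eq_zero.1 h0.symm)
  exact (div_eq_one_iff_eq hx0).1 this

end PadicExpLog

/-! ### Cube roots in ℚ_p. -/

section CubeRoots

variable {p : ℕ} [Fact p.Prime]

theorem norm_add_eq_left {x y : ℚ_[p]} (h : ‖y‖ < ‖x‖) : ‖x + y‖ = ‖x‖ := by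
  rw [Padic.add_eq_max_of_ne h.ne', max_eq_left h.le]

theorem norm_add_lt {x y : ℚ_[p]} {r : ℝ} (hx : ‖x‖ < r) (hy : ‖y‖ < r) : ‖x + y‖ < r :=
  (Padic.nonarchimedean _ _).trans_lt (max_lt hx hy)

theorem norm_natCast_eq_one_of_lt {n : ℕ} (hn : n ≠ 0) (h : n < p) : ‖(n : ℚ_[p])‖ = 1 := by
  rw [Padic.norm_natCast_eq_one_iff]
  exact Nat.coprime_of_lt_prime hn h Fact.out

/-- The difference of two cubes of points that are congruent to the same unit. -/
theorem norm_pow_three_sub_pow_three (hp : 3 < p) {w x y : ℚ_[p]} (hw : ‖w‖ = 1)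
    (hx : ‖x - w‖ < 1) (hy : ‖y - w‖ < 1) : ‖x ^ 3 - y ^ 3‖ = ‖x - y‖ := by
  have h3 : ‖(3 : ℚ_[p])‖ = 1 := by
    exact_mod_cast norm_natCast_eq_one_of_lt (p := p) (n := 3) (by norm_num) hp
  have hxn : ‖x‖ = 1 := by rw [Padic.norm_eq_of_norm_sub_lt_right (by rwa [hw]), hw]
  have e : x ^ 3 - y ^ 3 =
      (x - y) * (3 * w ^ 2 + ((x - w) * (x + w) + ((x - w) * y + (w * (y - w) +
        (y - w) * (y + w))))) := by ring
  have hyn : ‖y‖ = 1 := by rw [Padic.norm_eq_of_norm_sub_lt_right (by rwa [hw]), hw]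
  have hs : ∀ s : ℚ_[p], ‖s‖ = 1 → ‖s + w‖ ≤ 1 := fun s h =>
    (Padic.nonarchimedean _ _).trans (by rw [h, hw, max_self])
  rw [e, norm_mul, norm_add_eq_left, norm_mul, h3, norm_pow, hw, one_pow, mul_one, mul_one]
  rw [norm_mul, h3, norm_pow, hw, one_pow, mul_one]
  refine norm_add_lt ?_ (norm_add_lt ?_ (norm_add_lt ?_ ?_))
  · rw [norm_mul]; exact mul_lt_one_of_nonneg_of_lt_one_left (norm_nonneg _) hx (hs x hxn)
  · rwa [norm_mul, hyn, mul_one]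
  · rwa [norm_mul, hw, one_mul]
  · rw [norm_mul]; exact mul_lt_one_of_nonneg_of_lt_one_left (norm_nonneg _) hy (hs y hyn)

theorem norm_pow_three_sub_one (hp : 3 < p) {y : ℚ_[p]} (hy : ‖y - 1‖ < 1) :
    ‖y ^ 3 - 1‖ = ‖y - 1‖ := by
  simpa using norm_pow_three_sub_pow_three hp norm_one hy (y := 1) (by simp)

/-- Hensel's lemma for X^3 - x at w: the derivative 3w^2 is a unit because p > 3. -/
theorem exists_pow_three_eq (hp : 3 < p) {w x : ℚ_[p]} (hw : ‖w‖ = 1) (hw3 : ‖w ^ 3 - 1‖ < 1)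
    (hx : ‖x - 1‖ < 1) : ∃ y : ℚ_[p], ‖y - w‖ < 1 ∧ y ^ 3 = x := by
  have h3 : ‖(3 : ℚ_[p])‖ = 1 := by
    exact_mod_cast norm_natCast_eq_one_of_lt (p := p) (n := 3) (by norm_num) hp
  obtain ⟨W, rfl⟩ : ∃ W : ℤ_[p], (W : ℚ_[p]) = w := ⟨⟨w, hw.le⟩, rfl⟩
  obtain ⟨X, rfl⟩ : ∃ X : ℤ_[p], (X : ℚ_[p]) = x :=
    ⟨⟨x, (norm_eq_one_of_norm_sub_one_lt hx).le⟩, rfl⟩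
  have hd : ‖(Polynomial.X ^ 3 - Polynomial.C X : Polynomial ℤ_[p]).derivative.aeval W‖ = 1 := by
    rw [PadicInt.norm_def]
    simp only [Polynomial.derivative_sub, Polynomial.derivative_X_pow, Polynomial.derivative_C,
      sub_zero, map_mul, map_pow, Polynomial.aeval_X, map_natCast, PadicInt.coe_mul,
      PadicInt.coe_pow, norm_mul, norm_pow, hw, one_pow, mul_one, PadicInt.coe_natCast]
    exact_mod_cast h3
  obtain ⟨z, hz, hzw, -, -⟩ := hensels_lemma (p := p) (R := ℤ_[p])
    (F := (Polynomial.X ^ 3 - Polynomial.C X : Polynomial ℤ_[p])) (a := W) (by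
      rw [hd, one_pow, PadicInt.norm_def]
      have e : ((Polynomial.aeval W (Polynomial.X ^ 3 - Polynomial.C X : Polynomial ℤ_[p]) : ℤ_[p])
          : ℚ_[p]) = ((W : ℚ_[p]) ^ 3 - 1) + (1 - X) := by
        simp
      rw [e]
      exact norm_add_lt hw3 (by rwa [norm_sub_rev]))
  rw [hd, PadicInt.norm_def, PadicInt.coe_sub] at hzw
  refine ⟨z, hzw, ?_⟩
  have : z ^ 3 = X := by simpa [sub_eq_zero] using hz
  rw [← this, PadicInt.coe_pow]

/-- If `p ≡ 1 (mod 3)`, there are two nontrivial cube roots of unity modulo `p`. -/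
theorem exists_cube_roots_of_unity (hp : p ≡ 1 [MOD 3]) : ∃ w w' : ℚ_[p],
    (‖w‖ = 1 ∧ ‖w ^ 3 - 1‖ < 1 ∧ ‖w - 1‖ = 1) ∧
    (‖w'‖ = 1 ∧ ‖w' ^ 3 - 1‖ < 1 ∧ ‖w' - 1‖ = 1) ∧ ‖w' - w‖ = 1 := by
  have hdvd : 3 ∣ Fintype.card (ZMod p)ˣ := by
    rw [ZMod.card_units]
    exact (Nat.modEq_iff_dvd' (Nat.Prime.one_le Fact.out)).1 hp.symm
  obtain ⟨ζ, hζ⟩ := exists_prime_orderOf_dvd_card 3 hdvd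
  have hζ3 : (ζ : ZMod p) ^ 3 = 1 := by
    have := pow_orderOf_eq_one ζ
    rw [hζ] at this
    simpa using congrArg Units.val this
  have hζ1 : (ζ : ZMod p) ≠ 1 := by
    intro h
    have : ζ = 1 := Units.ext h
    rw [this, orderOf_one] at hζ
    norm_num at hζ
  set n : ℤ := ((ζ : ZMod p).val : ℤ) with hn
  have hnζ : (n : ZMod p) = ζ := by simp [hn]
  have h3 : ‖((n : ℚ_[p])) ^ 3 - 1‖ < 1 := by
    have : ‖((n ^ 3 - 1 : ℤ) : ℚ_[p])‖ < 1 := by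
      rw [Padic.norm_intCast_lt_one_iff, ← ZMod.intCast_zmod_eq_zero_iff_dvd]
      push_cast
      rw [hnζ, hζ3, sub_self]
    exact_mod_cast this
  have h1 : ‖(n : ℚ_[p]) - 1‖ = 1 := by
    refine le_antisymm (by exact_mod_cast Padic.norm_int_le_one (n - 1)) (not_lt.1 fun h => ?_)
    have h' : ‖((n - 1 : ℤ) : ℚ_[p])‖ < 1 := by exact_mod_cast h
    rw [Padic.norm_intCast_lt_one_iff, ← ZMod.intCast_zmod_eq_zero_iff_dvd] at h'
    push_cast at h'
    rw [hnζ, sub_eq_zero] at h'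
    exact hζ1 h'
  set w : ℚ_[p] := (n : ℚ_[p]) with hw
  have hw1 : ‖w‖ = 1 := by
    have := norm_eq_one_of_norm_sub_one_lt h3
    rw [norm_pow] at this
    exact (pow_eq_one_iff_of_nonneg (norm_nonneg _) (by norm_num)).1 this
  have hq : ‖w ^ 2 + w + 1‖ < 1 := by
    have e : w ^ 3 - 1 = (w - 1) * (w ^ 2 + w + 1) := by ring
    rwa [e, norm_mul, h1, one_mul] at h3
  have hadd : ‖w + 1‖ = 1 := by
    have e : w + 1 = -w ^ 2 + (w ^ 2 + w + 1) := by ring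
    have hm : ‖-w ^ 2‖ = 1 := by rw [norm_neg, norm_pow, hw1, one_pow]
    rw [e, norm_add_eq_left (by rwa [hm]), hm]
  -- The second root is w^2. It differs from 1 modulo p because w + 1 ≡ -w^2 is a unit.
  refine ⟨w, w ^ 2, ⟨hw1, h3, h1⟩, ⟨by rw [norm_pow, hw1, one_pow], ?_, ?_⟩, ?_⟩
  · have e : (w ^ 2) ^ 3 - 1 = w ^ 3 * w ^ 3 - 1 := by ring
    rw [e]
    exact norm_mul_sub_one_lt h3 h3
  · have e : w ^ 2 - 1 = (w - 1) * (w + 1) := by ring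
    rw [e, norm_mul, h1, hadd, one_mul]
  · have e : w ^ 2 - w = w * (w - 1) := by ring
    rw [e, norm_mul, hw1, h1, one_mul]

end CubeRoots

/-! ### Cycles of the Potts–Bethe mapping. -/

section Dynamics

variable {p : ℕ} [Fact p.Prime]

theorem pottsBetheDen_eq (θ : ℚ_[p]) (a q : ℕ) (z : ℚ_[p]) :
    pottsBetheDen θ a q z = a * (z - 1) + q + (θ - 1) := by
  rw [pottsBetheDen]; ring

theorem pottsBethe_eq {θ : ℚ_[p]} {a q : ℕ} (k : ℕ) {z : ℚ_[p]} (h : pottsBetheDen θ a q z ≠ 0) :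
    pottsBethe θ a q k z =
      (1 + (θ - 1) * (z - 1) / (a * (z - 1) + q + (θ - 1))) ^ k := by
  rw [pottsBethe, ← pottsBetheDen_eq, one_add_div h]
  congr 2
  rw [pottsBetheDen]; ring

variable {t a q : ℚ_[p]}

/-- One step of the Potts–Bethe mapping with `z = 1 + u`, when the denominator dominates. -/
theorem norm_step_eq (hp : 3 < p) {u v : ℚ_[p]}
    (huv : v = (1 + t * u / (a * u + q + t)) ^ 3 - 1)
    (h : ‖t * u‖ < ‖a * u + q + t‖) : ‖v‖ = ‖t * u‖ / ‖a * u + q + t‖ := by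
  have hlt : ‖1 + t * u / (a * u + q + t) - 1‖ < 1 := by
    rw [add_sub_cancel_left, norm_div]
    exact (div_lt_one ((norm_nonneg _).trans_lt h)).2 h
  rw [huv, norm_pow_three_sub_one hp hlt, add_sub_cancel_left, norm_div]

/-- Here q dominates the denominator, so the step contracts towards the fixed point u = 0. -/
theorem norm_step_of_lt (hp : 3 < p) (htq : ‖t‖ < ‖q‖) (hqa : ‖q‖ < ‖a‖) {u v : ℚ_[p]}
    (huv : v = (1 + t * u / (a * u + q + t)) ^ 3 - 1) (hu : ‖a‖ * ‖u‖ < ‖q‖) :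
    ‖v‖ = ‖t‖ / ‖q‖ * ‖u‖ := by
  have hq0 : 0 < ‖q‖ := (norm_nonneg _).trans_lt htq
  have hD : ‖a * u + q + t‖ = ‖q‖ := by
    rw [add_comm (a * u), add_assoc, norm_add_eq_left]
    exact norm_add_lt (by rwa [norm_mul]) htq
  have hu1 : ‖u‖ < 1 := by nlinarith
  rw [norm_step_eq hp huv, hD, norm_mul]
  · ring
  · rw [hD, norm_mul]
    nlinarith [norm_nonneg t]

/-- Here au dominates the denominator and u cancels from the norm. The image satisfies |av| = |t| <
|q|, hence lies in the contracted disc. -/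
theorem norm_step_of_gt (hp : 3 < p) (htq : ‖t‖ < ‖q‖) (hqa : ‖q‖ < ‖a‖) {u v : ℚ_[p]}
    (huv : v = (1 + t * u / (a * u + q + t)) ^ 3 - 1) (hu : ‖q‖ < ‖a‖ * ‖u‖) :
    ‖v‖ = ‖t‖ / ‖a‖ := by
  have hq0 : 0 < ‖q‖ := (norm_nonneg _).trans_lt htq
  have hu0 : 0 < ‖u‖ := by
    by_contra h
    nlinarith [norm_nonneg u, norm_nonneg a]
  have hD : ‖a * u + q + t‖ = ‖a‖ * ‖u‖ := by
    rw [add_assoc, norm_add_eq_left, norm_mul]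
    rw [norm_mul]
    exact norm_add_lt hu (htq.trans hu)
  rw [norm_step_eq hp huv, hD, norm_mul]
  · field_simp
  · rw [hD, norm_mul]
    exact mul_lt_mul_of_pos_right (htq.trans hqa) hu0

variable {m : ℕ} {U : ℕ → ℚ_[p]}

/-- A cycle is either constant equal to the fixed point `1` or lies on the circle
`|z - 1| = |q / a|`. -/
theorem cycle_dichotomy (hp : 3 < p) (htq : ‖t‖ < ‖q‖) (hqa : ‖q‖ < ‖a‖) (hm : 0 < m)
    (hper : ∀ n, U (n + m) = U n)
    (hstep : ∀ n, U n = (1 + t * U (n + 1) / (a * U (n + 1) + q + t)) ^ 3 - 1) :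
    (∀ n, U n = 0) ∨ ∀ n, ‖a‖ * ‖U n‖ = ‖q‖ := by
  have hq0 : 0 < ‖q‖ := (norm_nonneg _).trans_lt htq
  have hc : ‖t‖ / ‖q‖ < 1 := (div_lt_one hq0).2 htq
  by_cases hex : ∃ n, ‖a‖ * ‖U n‖ < ‖q‖
  · left
    obtain ⟨n₀, hn₀⟩ := hex
    -- The sequence runs against the dynamics: `U n` is the image of `U (n + 1)`, so smallness
    -- propagates to lower indices. Over a whole period it gives |U n| = (|t|/|q|)^m |U n|, which
    -- forces U n = 0.
    have hback : ∀ k n, ‖a‖ * ‖U (n + k)‖ < ‖q‖ →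
        ‖a‖ * ‖U n‖ < ‖q‖ ∧ ‖U n‖ = (‖t‖ / ‖q‖) ^ k * ‖U (n + k)‖ := by
      intro k
      induction k with
      | zero => intro n h; exact ⟨h, by simp⟩
      | succ k ih =>
        intro n h
        have h1 := norm_step_of_lt hp htq hqa (hstep (n + k)) h
        have h2 : ‖a‖ * ‖U (n + k)‖ < ‖q‖ := by
          refine lt_of_le_of_lt ?_ h
          rw [h1]
          exact mul_le_mul_of_nonneg_left (mul_le_of_le_one_left (norm_nonneg _) hc.le)
            (norm_nonneg _)
        refine ⟨(ih n h2).1, ?_⟩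
        rw [(ih n h2).2, h1, pow_succ, mul_assoc]
        rfl
    have hper' : ∀ k, U (n₀ + m * k) = U n₀ := by
      intro k
      induction k with
      | zero => simp
      | succ k ih => rw [mul_add, mul_one, ← add_assoc, hper, ih]
    have hall : ∀ n, ‖a‖ * ‖U n‖ < ‖q‖ := by
      intro n
      have hle : n ≤ n₀ + m * n := by nlinarith
      obtain ⟨k, hk⟩ := Nat.exists_eq_add_of_le hle
      refine (hback k n ?_).1
      rwa [← hk, hper']
    intro n
    have h := (hback m n (hall _)).2
    rw [hper] at h
    have hcm : (‖t‖ / ‖q‖) ^ m < 1 := pow_lt_one₀ (by positivity) hc hm.ne'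
    refine norm_eq_zero.1 ?_
    nlinarith [norm_nonneg (U n)]
  · right
    push Not at hex
    intro n
    refine le_antisymm (not_lt.1 fun h => ?_) (hex n)
    obtain ⟨k, rfl⟩ : ∃ k, m = k + 1 := ⟨m - 1, by omega⟩
    have h1 : ‖q‖ < ‖a‖ * ‖U (n + k + 1)‖ := by
      rw [add_assoc, hper]; exact h
    have h2 := norm_step_of_gt hp htq hqa (hstep (n + k)) h1
    have h3 := hex (n + k)
    have ha0 : 0 < ‖a‖ := hq0.trans hqa
    rw [h2, mul_div_cancel₀ _ ha0.ne'] at h3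
    linarith

theorem cycle_norm_lt_one (hp : 3 < p) (htq : ‖t‖ < ‖q‖) (hqa : ‖q‖ < ‖a‖) (hm : 0 < m)
    (hper : ∀ n, U (n + m) = U n)
    (hstep : ∀ n, U n = (1 + t * U (n + 1) / (a * U (n + 1) + q + t)) ^ 3 - 1) (n : ℕ) :
    ‖U n‖ < 1 := by
  rcases cycle_dichotomy hp htq hqa hm hper hstep with h | h
  · simp [h]
  · have := h n
    have hq0 : 0 < ‖q‖ := (norm_nonneg _).trans_lt htq
    by_contra hcon
    nlinarith

/-- On a cycle the partition function of a single site does not vanish. -/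
theorem cycle_add_ne_zero (hp : 3 < p) (ht : 0 < ‖t‖) (htq : ‖t‖ < ‖q‖) (hqa : ‖q‖ < ‖a‖)
    (hm : 0 < m) (hper : ∀ n, U (n + m) = U n)
    (hstep : ∀ n, U n = (1 + t * U (n + 1) / (a * U (n + 1) + q + t)) ^ 3 - 1) (n : ℕ) :
    a * U n + q ≠ 0 := by
  have hq0 : 0 < ‖q‖ := (norm_nonneg _).trans_lt htq
  rcases cycle_dichotomy hp htq hqa hm hper hstep with h | h
  · rw [h, mul_zero, zero_add]
    exact norm_pos_iff.1 hq0
  intro h0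
  -- Two added periods leave room for the two images, of indices l + 1 and l, that follow the bad
  -- point under the map.
  obtain ⟨l, hl⟩ : ∃ l, n + m + m = l + 2 := ⟨n + m + m - 2, by omega⟩
  have h0' : a * U (l + 2) + q = 0 := by rw [← hl, hper, hper, h0]
  have ht0 : t ≠ 0 := norm_pos_iff.1 ht
  set v := U (l + 2) with hv
  have hv1 : ‖v‖ < 1 := cycle_norm_lt_one hp htq hqa hm hper hstep _
  have h1 : U (l + 1) = (1 + v) ^ 3 - 1 := by
    rw [hstep (l + 1)]
    change (1 + t * v / (a * v + q + t)) ^ 3 - 1 = _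
    rw [h0', zero_add, mul_div_cancel_left₀ _ ht0]
  have h2 : ‖(2 : ℚ_[p])‖ = 1 := by
    exact_mod_cast norm_natCast_eq_one_of_lt (p := p) (n := 2) (by norm_num) (by omega)
  have h3 : ‖(3 : ℚ_[p])‖ = 1 := by
    exact_mod_cast norm_natCast_eq_one_of_lt (p := p) (n := 3) (by norm_num) hp
  -- When av + q = 0 the denominator at v is t, so the image of v is u = 3v + 3v^2 + v^3. Replacing
  -- av by -q gives au + q ≡ -2q up to terms smaller than |q|. The next image u' then satisfies
  -- |au'| = |t|, which is off the circle |au'| = |q|.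
  have hD : ‖a * U (l + 1) + q + t‖ = ‖q‖ := by
    have e : a * U (l + 1) + q + t = -(2 * q) + (t + (-(3 * q * v) + -(q * v * v))) := by
      rw [h1]
      linear_combination (3 + 3 * v + v ^ 2) * h0'
    have hqv : ‖q * v‖ < ‖q‖ := by rw [norm_mul]; nlinarith
    have hn : ‖-(2 * q)‖ = ‖q‖ := by rw [norm_neg, norm_mul, h2, one_mul]
    rw [e, norm_add_eq_left, hn]
    rw [hn]
    refine norm_add_lt htq (norm_add_lt ?_ ?_)
    · rwa [norm_neg, mul_assoc, norm_mul, h3, one_mul]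
    · rw [norm_neg, norm_mul]
      nlinarith [norm_nonneg v, norm_nonneg (q * v)]
  have hu := h (l + 1)
  have hu1 : ‖U (l + 1)‖ < 1 := cycle_norm_lt_one hp htq hqa hm hper hstep _
  have hlast := norm_step_eq hp (hstep l) (by
    rw [hD, norm_mul]; nlinarith [norm_nonneg t])
  have hl0 := h l
  rw [hlast, hD, norm_mul] at hl0
  have hcontr : ‖a‖ * (‖t‖ * ‖U (l + 1)‖ / ‖q‖) = ‖t‖ := by
    rw [← mul_div_assoc, mul_left_comm, hu, mul_div_assoc, div_self hq0.ne', mul_one]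
  linarith

/-- The inverse branches of the Potts–Bethe mapping: `y` is a cube root of the given point. -/
theorem exists_inverse_branch (hp : 3 < p) (ht : 0 < ‖t‖) (htq : ‖t‖ < ‖q‖) (hqa : ‖q‖ < ‖a‖)
    {w : ℚ_[p]} (hw : ‖w‖ = 1) (hw3 : ‖w ^ 3 - 1‖ < 1) (hw1 : ‖w - 1‖ = 1) :
    ∃ g : ℚ_[p] → ℚ_[p],
      (∀ x, ‖x - 1‖ < 1 → ‖a‖ * ‖g x - 1‖ = ‖q‖ ∧ a * (g x - 1) + q + t ≠ 0 ∧
        (1 + t * (g x - 1) / (a * (g x - 1) + q + t)) ^ 3 = x ∧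
        ‖1 + t * (g x - 1) / (a * (g x - 1) + q + t) - w‖ < 1) ∧
      ∀ x x', ‖x - 1‖ < 1 → ‖x' - 1‖ < 1 → ‖g x - g x'‖ ≤ ‖t‖ / ‖a‖ * ‖x - x'‖ := by
  have hq0 : 0 < ‖q‖ := (norm_nonneg _).trans_lt htq
  have ha0 : 0 < ‖a‖ := hq0.trans hqa
  have hc : ∀ x : ℚ_[p], ∃ y : ℚ_[p], ‖x - 1‖ < 1 → ‖y - w‖ < 1 ∧ y ^ 3 = x := by
    intro x
    by_cases hx : ‖x - 1‖ < 1
    · obtain ⟨y, hy⟩ := exists_pow_three_eq hp hw hw3 hx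
      exact ⟨y, fun _ => hy⟩
    · exact ⟨0, fun h => absurd h hx⟩
  choose c hc using hc
  have hc1 : ∀ x, ‖x - 1‖ < 1 → ‖c x - 1‖ = 1 := by
    intro x hx
    have e : c x - 1 = (w - 1) + (c x - w) := by ring
    rw [e, norm_add_eq_left (by rw [hw1]; exact (hc x hx).1), hw1]
  have hden : ∀ x, ‖x - 1‖ < 1 → ‖t - a * (c x - 1)‖ = ‖a‖ := by
    intro x hx
    have hn : ‖-(a * (c x - 1))‖ = ‖a‖ := by rw [norm_neg, norm_mul, hc1 x hx, mul_one]
    rw [sub_eq_neg_add, norm_add_eq_left (by rw [hn]; exact htq.trans hqa), hn]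
  have hden0 : ∀ x, ‖x - 1‖ < 1 → t - a * (c x - 1) ≠ 0 := fun x hx =>
    norm_pos_iff.1 (by rwa [hden x hx])
  have hqt : ‖q + t‖ = ‖q‖ := norm_add_eq_left htq
  have hqt0 : q + t ≠ 0 := norm_pos_iff.1 (by rwa [hqt])
  have ht0 : t ≠ 0 := norm_pos_iff.1 ht
  -- Solving c = 1 + tu/(au + q + t) for u gives u = (c - 1)(q + t)/(t - a(c - 1)), where c is the
  -- cube root of x close to w. Since w is not 1 modulo p, |c - 1| = 1 and the denominator has norm
  -- |a|.
  refine ⟨fun x => 1 + (c x - 1) * (q + t) / (t - a * (c x - 1)), fun x hx => ?_,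
    fun x x' hx hx' => ?_⟩
  · have h0 := hden0 x hx
    simp only [add_sub_cancel_left]
    have hD : a * ((c x - 1) * (q + t) / (t - a * (c x - 1))) + q + t =
        (q + t) * t / (t - a * (c x - 1)) := by
      field_simp
      ring
    have hf : 1 + t * ((c x - 1) * (q + t) / (t - a * (c x - 1))) /
        (a * ((c x - 1) * (q + t) / (t - a * (c x - 1))) + q + t) = c x := by
      rw [hD]
      generalize t - a * (c x - 1) = d at h0
      field_simp
      ring
    refine ⟨?_, ?_, ?_, ?_⟩
    · rw [norm_div, norm_mul, hden x hx, hc1 x hx, hqt, one_mul, mul_div_cancel₀ _ ha0.ne']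
    · rw [hD]
      exact div_ne_zero (mul_ne_zero hqt0 ht0) h0
    · rw [hf, (hc x hx).2]
    · rw [hf]; exact (hc x hx).1
  · have h0 := hden0 x hx
    have h0' := hden0 x' hx'
    have e : 1 + (c x - 1) * (q + t) / (t - a * (c x - 1)) -
        (1 + (c x' - 1) * (q + t) / (t - a * (c x' - 1))) =
        (q + t) * t * (c x - c x') / ((t - a * (c x - 1)) * (t - a * (c x' - 1))) := by
      rw [add_sub_add_left_eq_sub, div_sub_div _ _ h0 h0']
      congr 1
      ring
    have hcc : ‖c x - c x'‖ = ‖x - x'‖ := by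
      rw [← norm_pow_three_sub_pow_three hp hw (hc x hx).1 (hc x' hx').1, (hc x hx).2,
        (hc x' hx').2]
    simp only [e]
    rw [norm_div, norm_mul, norm_mul, norm_mul, hden x hx, hden x' hx', hqt, hcc,
      show ‖q‖ * ‖t‖ * ‖x - x'‖ / (‖a‖ * ‖a‖) = ‖q‖ / ‖a‖ * (‖t‖ / ‖a‖ * ‖x - x'‖) by
        field_simp]
    exact mul_le_of_le_one_left (by positivity) ((div_le_one ha0).2 hqa.le)

/-- There are cycles of the Potts–Bethe mapping with any prescribed itinerary. -/
theorem exists_cycle (hp : 3 < p) (ht : 0 < ‖t‖) (htq : ‖t‖ < ‖q‖) (hqa : ‖q‖ < ‖a‖)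
    {m : ℕ} [NeZero m] (w : Fin m → ℚ_[p]) (hw : ∀ j, ‖w j‖ = 1 ∧ ‖w j ^ 3 - 1‖ < 1 ∧
      ‖w j - 1‖ = 1) :
    ∃ z : Fin m → ℚ_[p], ∀ j, ‖a‖ * ‖z j - 1‖ = ‖q‖ ∧ a * (z j - 1) + q + t ≠ 0 ∧
      (1 + t * (z (j + 1) - 1) / (a * (z (j + 1) - 1) + q + t)) ^ 3 = z j ∧
      ‖1 + t * (z j - 1) / (a * (z j - 1) + q + t) - w j‖ < 1 := by
  have hq0 : 0 < ‖q‖ := (norm_nonneg _).trans_lt htq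
  have ha0 : 0 < ‖a‖ := hq0.trans hqa
  choose g hg hgl using fun j =>
    exists_inverse_branch hp ht htq hqa (hw j).1 (hw j).2.1 (hw j).2.2
  set s : Set (Fin m → ℚ_[p]) := {z | ∀ j, ‖z j - 1‖ ≤ (p : ℝ)⁻¹} with hs
  have hp1 : (p : ℝ)⁻¹ < 1 := inv_lt_one_of_one_lt₀ (by exact_mod_cast (by omega : 1 < p))
  have hlt : ∀ z ∈ s, ∀ j, ‖z j - 1‖ < 1 := fun z hz j => (hz j).trans_lt hp1
  have hclosed : IsClosed s := by
    rw [hs, Set.ofPred_forall]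
    exact isClosed_iInter fun j => isClosed_le (by fun_prop) continuous_const
  -- A fixed point satisfies z_j = g_j(z_{j-1}); applying the map yields G(z_j) = z_{j-1}, the cycle
  -- equation.
  set Φ : (Fin m → ℚ_[p]) → Fin m → ℚ_[p] := fun z j => g j (z (j - 1)) with hΦ
  have hmaps : Set.MapsTo Φ s s := by
    intro z hz j
    refine norm_le_inv_of_norm_lt_one ?_
    have := (hg j _ (hlt z hz (j - 1))).1
    by_contra hcon
    change ¬ ‖g j (z (j - 1)) - 1‖ < 1 at hcon
    nlinarith
  set K : NNReal := ‖t‖₊ / ‖a‖₊ with hK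
  have hKc : (K : ℝ) = ‖t‖ / ‖a‖ := by simp [hK]
  have hK1 : K < 1 := by
    rw [← NNReal.coe_lt_coe, hKc, NNReal.coe_one]
    exact (div_lt_one ha0).2 (htq.trans hqa)
  have hcontr : ContractingWith K (hmaps.restrict Φ s s) := by
    refine ⟨hK1, LipschitzWith.of_dist_le_mul fun x y => ?_⟩
    change dist (Φ x) (Φ y) ≤ K * dist (x : Fin m → ℚ_[p]) y
    rw [dist_pi_le_iff (by positivity)]
    intro j
    rw [dist_eq_norm, hKc]
    refine (hgl j _ _ (hlt x x.2 _) (hlt y y.2 _)).trans ?_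
    rw [← dist_eq_norm]
    exact mul_le_mul_of_nonneg_left (dist_le_pi_dist _ _ _) (by positivity)
  obtain ⟨z, hzs, hz, -⟩ := hcontr.exists_fixedPoint' hclosed.isComplete hmaps
    (x := fun _ => 1) (by intro j; simp) (edist_ne_top _ _)
  have hzj : ∀ j, g j (z (j - 1)) = z j := fun j => congrFun hz j
  refine ⟨z, fun j => ?_⟩
  have h1 := hg j _ (hlt z hzs (j - 1))
  have h2 := hg (j + 1) _ (hlt z hzs (j + 1 - 1))
  rw [hzj] at h1 h2
  refine ⟨h1.1, h1.2.1, ?_, h1.2.2.2⟩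
  rw [h2.2.2.1, add_sub_cancel_right]

theorem ofNat_succ_eq {m : ℕ} [NeZero m] (n : ℕ) : Fin.ofNat m (n + 1) = Fin.ofNat m n + 1 := by
  ext
  simp [Fin.val_add, Nat.add_mod]

/-- The itinerary takes the value w' only at index 0. If z_i = z_j, applying the map i times gives
z_0 = z_{j-i}; for i ≠ j one number would then be congruent to both w' and w. -/
theorem exists_injective_cycle (hp : p ≡ 1 [MOD 3]) (hp3 : 3 < p) (ht : 0 < ‖t‖)
    (htq : ‖t‖ < ‖q‖) (hqa : ‖q‖ < ‖a‖) (m : ℕ) [NeZero m] :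
    ∃ z : Fin m → ℚ_[p], (∀ j, a * (z j - 1) + q + t ≠ 0 ∧
      (1 + t * (z (j + 1) - 1) / (a * (z (j + 1) - 1) + q + t)) ^ 3 = z j) ∧
      Function.Injective z ∧ ∀ j, z j ≠ 1 := by
  have hq0 : 0 < ‖q‖ := (norm_nonneg _).trans_lt htq
  obtain ⟨w, w', hw, hw', hww⟩ := exists_cube_roots_of_unity hp
  obtain ⟨z, hz⟩ := exists_cycle hp3 ht htq hqa (fun j : Fin m => if j = 0 then w' else w)
    (fun j => by split_ifs <;> assumption)
  refine ⟨z, fun j => ⟨(hz j).2.1, (hz j).2.2.1⟩, fun i j hij => ?_, fun j h => ?_⟩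
  · have hback : ∀ n : ℕ, z (i - Fin.ofNat m n) = z (j - Fin.ofNat m n) := by
      intro n
      induction n with
      | zero => simpa using hij
      | succ n ih =>
        have e : ∀ l : Fin m, l - Fin.ofNat m n = (l - Fin.ofNat m (n + 1)) + 1 := by
          intro l
          rw [ofNat_succ_eq]
          abel
        rw [e, e] at ih
        rw [← (hz _).2.2.1, ih, (hz _).2.2.1]
    have h0 := hback i.val
    have hi : Fin.ofNat m i.val = i := by ext; simp
    rw [hi, sub_self] at h0
    by_contra hne
    have hji : j - i ≠ 0 := sub_ne_zero.2 (Ne.symm hne)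
    have h1 := (hz 0).2.2.2
    have h2 := (hz (j - i)).2.2.2
    rw [if_pos rfl, h0] at h1
    rw [if_neg hji] at h2
    set f := 1 + t * (z (j - i) - 1) / (a * (z (j - i) - 1) + q + t)
    have h3 : ‖(f - w) + (w' - f)‖ < 1 := norm_add_lt h2 (by rwa [norm_sub_rev])
    rw [show (f - w) + (w' - f) = w' - w by ring, hww] at h3
    exact lt_irrefl _ h3
  · have := (hz j).1
    rw [h, sub_self, norm_zero, mul_zero] at this
    exact hq0.ne this

end Dynamics

/-! ### Finitely additive measures from compatible families. -/

section CylinderContent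

variable {p : ℕ} [Fact p.Prime] {k q : ℕ}

/-- The restriction of a configuration to `V_n`. -/
def restrictBall (n : ℕ) (ω : Config k q) : VolConfig k q n := fun v => ω v

/-- The extension of a configuration on `V_n` by the constant spin `d`. -/
def extendConst (d : Fin q) {n : ℕ} (σ : VolConfig k q n) : Config k q := fun v =>
  if h : v ∈ ball k n then σ ⟨v, h⟩ else d

theorem restrictBall_extendConst (d : Fin q) {n : ℕ} (σ : VolConfig k q n) :
    restrictBall n (extendConst d σ) = σ := by
  ext v
  simp [restrictBall, extendConst]

theorem level_subset_ball (n : ℕ) : level k n ⊆ ball k n := fun x hx => by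
  rw [mem_level] at hx
  rw [mem_ball]
  omega

theorem ball_mono {n n' : ℕ} (h : n ≤ n') : ball k n ⊆ ball k n' := fun x hx => by
  rw [mem_ball] at hx ⊢
  omega

theorem not_mem_ball_of_mem_level_succ {n : ℕ} {x : Vertex k} (hx : x ∈ level k (n + 1)) :
    x ∉ ball k n := by
  rw [mem_level] at hx
  rw [mem_ball]
  omega

/-- A configuration on `V_{n+1}` is a pair of configurations on `V_n` and on `W_{n+1}`. -/
def concatEquiv (k q n : ℕ) :
    VolConfig k q n × LevelConfig k q (n + 1) ≃ VolConfig k q (n + 1) where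
  toFun στ := concat στ.1 στ.2
  invFun σ := (fun v => σ ⟨v, ball_mono n.le_succ v.2⟩, fun v => σ ⟨v, level_subset_ball _ v.2⟩)
  left_inv στ := by
    ext v
    · simp [concat]
    · simp [concat, not_mem_ball_of_mem_level_succ v.2]
  right_inv σ := by
    ext v
    by_cases h : (v : Vertex k) ∈ ball k n <;> simp [concat, h]

theorem sum_volConfig_succ {M : Type*} [AddCommMonoid M] (n : ℕ) (f : VolConfig k q (n + 1) → M) :
    ∑ σ, f σ = ∑ σ : VolConfig k q n, ∑ τ, f (concat σ τ) := by
  rw [← Fintype.sum_prod_type']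
  exact ((concatEquiv k q n).sum_comp f).symm

/-- The set `A` of configurations only depends on the spins in `V_n`. -/
def IsLocal (n : ℕ) (A : Set (Config k q)) : Prop :=
  ∀ ω ω' : Config k q, (∀ v ∈ ball k n, ω v = ω' v) → ω ∈ A → ω' ∈ A

theorem IsLocal.mono {n n' : ℕ} {A : Set (Config k q)} (hA : IsLocal n A) (h : n ≤ n') :
    IsLocal n' A := fun ω ω' hω => hA ω ω' fun v hv => hω v (ball_mono h hv)

theorem isLocal_cylinder {n : ℕ} (S : Set (VolConfig k q n)) :
    IsLocal n (MeasureTheory.cylinder (ball k n) S : Set (Config k q)) := fun ω ω' h hω => by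
  rw [MeasureTheory.mem_cylinder] at hω ⊢
  convert hω using 1
  ext v
  rw [Finset.restrict, Finset.restrict, h v v.2]

theorem exists_isLocal {A : Set (Config k q)}
    (hA : A ∈ MeasureTheory.measurableCylinders fun _ : Vertex k => Fin q) :
    ∃ n, IsLocal n A := by
  obtain ⟨s, S, -, rfl⟩ := (MeasureTheory.mem_measurableCylinders _).1 hA
  refine ⟨s.sup List.length, fun ω ω' h hω => ?_⟩
  rw [MeasureTheory.mem_cylinder] at hω ⊢
  convert hω using 1
  ext v
  rw [Finset.restrict, Finset.restrict, h v (mem_ball.2 (Finset.le_sup (f := List.length) v.2))]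

theorem exists_isLocal_of_subset (I : Finset (Set (Config k q)))
    (hI : ↑I ⊆ MeasureTheory.measurableCylinders fun _ : Vertex k => Fin q) :
    ∃ n, ∀ A ∈ I, IsLocal n A := by
  have h : ∀ A : Set (Config k q), ∃ n, A ∈ I → IsLocal n A := by
    intro A
    by_cases hA : A ∈ I
    · obtain ⟨n, hn⟩ := exists_isLocal (hI hA)
      exact ⟨n, fun _ => hn⟩
    · exact ⟨0, fun h => absurd h hA⟩
  choose n hn using h
  exact ⟨I.sup n, fun A hA => (hn A hA).mono (Finset.le_sup hA)⟩

theorem IsLocal.sUnion {n : ℕ} {I : Finset (Set (Config k q))} (hI : ∀ A ∈ I, IsLocal n A) :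
    IsLocal n (⋃₀ (I : Set (Set (Config k q)))) := fun ω ω' h hω => by
  obtain ⟨A, hA, hωA⟩ := hω
  exact ⟨A, hA, hI A hA ω ω' h hωA⟩

/-- A family of functions on the finite volume configurations that is compatible. -/
def CompatibleFamily (F : ∀ n, VolConfig k q n → ℚ_[p]) : Prop :=
  ∀ (n : ℕ) (σ : VolConfig k q n), ∑ τ : LevelConfig k q (n + 1), F (n + 1) (concat σ τ) = F n σ

open Classical in
/-- The sum of `F n` over the configurations on `V_n` whose extension lies in `A`. -/
def localMass (F : ∀ n, VolConfig k q n → ℚ_[p]) (d : Fin q) (n : ℕ) (A : Set (Config k q)) :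
    ℚ_[p] :=
  ∑ σ : VolConfig k q n, if extendConst d σ ∈ A then F n σ else 0

variable {F : ∀ n, VolConfig k q n → ℚ_[p]}

/-- Membership in A ignores the spins on W_{n+1}, so the inner sum over them collapses by
compatibility. -/
theorem localMass_succ (hF : CompatibleFamily F) (d : Fin q) {n : ℕ} {A : Set (Config k q)}
    (hA : IsLocal n A) : localMass F d (n + 1) A = localMass F d n A := by
  classical
  rw [localMass, localMass, sum_volConfig_succ]
  refine Finset.sum_congr rfl fun σ _ => ?_
  have hagree : ∀ (τ : LevelConfig k q (n + 1)), ∀ v ∈ ball k n,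
      extendConst d (concat σ τ) v = extendConst d σ v := fun τ v hv => by
    simp [extendConst, concat, hv, ball_mono n.le_succ hv]
  have hiff : ∀ τ : LevelConfig k q (n + 1),
      extendConst d (concat σ τ) ∈ A ↔ extendConst d σ ∈ A := fun τ =>
    ⟨hA _ _ (hagree τ), hA _ _ fun v hv => (hagree τ v hv).symm⟩
  simp only [hiff]
  split_ifs
  · exact hF n σ
  · simp

theorem localMass_eq_of_le (hF : CompatibleFamily F) (d : Fin q) {n n' : ℕ} (h : n ≤ n')
    {A : Set (Config k q)} (hA : IsLocal n A) : localMass F d n' A = localMass F d n A := by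
  induction n', h using Nat.le_induction with
  | base => rfl
  | succ l hl ih => rw [localMass_succ hF d (hA.mono hl), ih]

open Classical in
/-- The common value of the `localMass F d n A`, for all large `n`. -/
def cylinderMass (F : ∀ n, VolConfig k q n → ℚ_[p]) (d : Fin q) (A : Set (Config k q)) : ℚ_[p] :=
  if h : ∃ n, IsLocal n A then localMass F d (Nat.find h) A else 0

theorem cylinderMass_eq (hF : CompatibleFamily F) (d : Fin q) {n : ℕ} {A : Set (Config k q)}
    (hA : IsLocal n A) : cylinderMass F d A = localMass F d n A := by
  classical
  have h : ∃ n, IsLocal n A := ⟨n, hA⟩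
  rw [cylinderMass, dif_pos h]
  exact (localMass_eq_of_le hF d (Nat.find_min' h hA) (Nat.find_spec h)).symm

theorem localMass_sUnion (d : Fin q) (n : ℕ) {I : Finset (Set (Config k q))}
    (hI : Set.PairwiseDisjoint (I : Set (Set (Config k q))) id) :
    localMass F d n (⋃₀ (I : Set (Set (Config k q)))) = ∑ A ∈ I, localMass F d n A := by
  classical
  simp only [localMass]
  rw [Finset.sum_comm]
  refine Finset.sum_congr rfl fun σ _ => ?_
  split_ifs with h
  · obtain ⟨A, hA, hσ⟩ := h
    rw [Finset.sum_eq_single_of_mem A hA, if_pos hσ]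
    intro B hB hBA
    refine if_neg fun hσB => ?_
    exact Set.disjoint_left.1 (hI hB hA hBA) hσB hσ
  · refine (Finset.sum_eq_zero fun A hA => if_neg fun hσ => h ⟨A, hA, hσ⟩).symm

/-- The finitely additive measure on the cylinder sets given by a compatible family. -/
def cylinderContent (hF : CompatibleFamily F) (d : Fin q) : PadicMeasure p k q where
  toFun := cylinderMass F d
  empty' := by
    rw [cylinderMass_eq hF d (n := 0) fun _ _ _ h => h]
    simp [localMass]
  sUnion' I hI hdis _ := by
    obtain ⟨n, hn⟩ := exists_isLocal_of_subset I hI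
    rw [cylinderMass_eq hF d (IsLocal.sUnion hn), localMass_sUnion d n hdis]
    exact Finset.sum_congr rfl fun A hA => (cylinderMass_eq hF d (hn A hA)).symm

theorem extendConst_mem_cylinder (d : Fin q) {n : ℕ} (σ : VolConfig k q n)
    (S : Set (VolConfig k q n)) :
    extendConst d σ ∈ (MeasureTheory.cylinder (ball k n) S : Set (Config k q)) ↔ σ ∈ S := by
  rw [MeasureTheory.mem_cylinder]
  change restrictBall n (extendConst d σ) ∈ S ↔ _
  rw [restrictBall_extendConst]

theorem cylinderContent_cylinder (hF : CompatibleFamily F) (d : Fin q) {n : ℕ}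
    (σ : VolConfig k q n) :
    cylinderContent hF d (MeasureTheory.cylinder (ball k n) {σ}) = F n σ := by
  classical
  change cylinderMass F d _ = _
  rw [cylinderMass_eq hF d (isLocal_cylinder _), localMass]
  simp only [extendConst_mem_cylinder, Set.mem_singleton_iff]
  simp

/-- A measure on the cylinder sets is determined by its finite volume distributions. -/
theorem padicMeasure_ext (d : Fin q) {μ ν : PadicMeasure p k q}
    (h : ∀ (n : ℕ) (σ : VolConfig k q n), ν (MeasureTheory.cylinder (ball k n) {σ}) =
      μ (MeasureTheory.cylinder (ball k n) {σ}))
    {A : Set (Config k q)}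
    (hA : A ∈ MeasureTheory.measurableCylinders fun _ : Vertex k => Fin q) : ν A = μ A := by
  classical
  obtain ⟨n, hn⟩ := exists_isLocal hA
  set s : Finset (VolConfig k q n) := Finset.univ.filter fun σ => extendConst d σ ∈ A with hs
  have hagree : ∀ ω : Config k q, ∀ v ∈ ball k n,
      extendConst d (restrictBall n ω) v = ω v := fun ω v hv => by
    simp [extendConst, restrictBall, hv]
  have hAeq : A = ⋃ σ ∈ s, (MeasureTheory.cylinder (ball k n) {σ} : Set (Config k q)) := by
    ext ω
    simp only [Set.mem_iUnion, MeasureTheory.mem_cylinder, Set.mem_singleton_iff, exists_prop, hs,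
      Finset.mem_filter, Finset.mem_univ, true_and]
    constructor
    · intro hω
      exact ⟨restrictBall n ω, hn _ _ (fun v hv => (hagree ω v hv).symm) hω, rfl⟩
    · rintro ⟨σ, hσ, rfl⟩
      exact hn _ _ (hagree ω) hσ
  have hmem : ∀ σ ∈ s, (MeasureTheory.cylinder (ball k n) {σ} : Set (Config k q)) ∈
      MeasureTheory.measurableCylinders fun _ : Vertex k => Fin q := fun σ _ =>
    MeasureTheory.cylinder_mem_measurableCylinders _ _ (MeasurableSet.singleton σ)
  have hdis : Set.PairwiseDisjoint (s : Set (VolConfig k q n)) fun σ =>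
      (MeasureTheory.cylinder (ball k n) {σ} : Set (Config k q)) := by
    intro σ _ σ' _ hne
    refine Set.disjoint_left.2 fun ω hω hω' => hne ?_
    rw [MeasureTheory.mem_cylinder, Set.mem_singleton_iff] at hω hω'
    rw [← hω, hω']
  rw [hAeq] at hA ⊢
  rw [MeasureTheory.addContent_biUnion hmem hdis hA, MeasureTheory.addContent_biUnion hmem hdis hA]
  exact Finset.sum_congr rfl fun σ _ => h n σ

end CylinderContent

/-! ### Boltzmann weights and the consistency equation on the tree. -/

section Weights

variable {p : ℕ} [Fact p.Prime] {k q : ℕ}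

/-- Each vertex other than the root has exactly one edge to its predecessor, the word without its
last letter. -/
theorem prod_edges {M : Type*} [CommMonoid M] (n : ℕ) (f : Vertex k → Vertex k → M) :
    ∏ e ∈ edges k n, f e.1 e.2 = ∏ y ∈ (ball k n).erase [], f y.dropLast y := by
  have hmem : ∀ e ∈ edges k n, (e.1 : Vertex k) = (e.2 : Vertex k).dropLast ∧
      (e.2 : Vertex k) ≠ [] := by
    intro e he
    obtain ⟨i, -, hi⟩ := Finset.mem_image.1 (Finset.mem_filter.1 he).2
    rw [← hi]
    simp
  have hb : ∀ y ∈ (ball k n).erase [], y.dropLast ∈ ball k n := by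
    intro y hy
    have := mem_ball.1 (Finset.mem_of_mem_erase hy)
    rw [mem_ball, List.length_dropLast]
    omega
  refine Finset.prod_bij' (fun e _ => (e.2 : Vertex k))
    (fun y hy => (⟨y.dropLast, hb y hy⟩, ⟨y, Finset.mem_of_mem_erase hy⟩)) ?_ ?_ ?_ ?_ ?_
  · intro e he
    exact Finset.mem_erase.2 ⟨(hmem e he).2, e.2.2⟩
  · intro y hy
    refine Finset.mem_filter.2 ⟨Finset.mem_univ _, Finset.mem_image.2
      ⟨y.getLast (Finset.ne_of_mem_erase hy), Finset.mem_univ _, ?_⟩⟩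
    exact List.dropLast_append_getLast _
  · intro e he
    exact Prod.ext (Subtype.ext (hmem e he).1.symm) rfl
  · intro y hy
    rfl
  · intro e he
    rw [(hmem e he).1]

theorem prod_level_succ {M : Type*} [CommMonoid M] (n : ℕ) (f : Vertex k → M) :
    ∏ y ∈ level k (n + 1), f y.dropLast = ∏ x ∈ level k n, f x ^ k := by
  have h : ∏ e ∈ level k n ×ˢ (Finset.univ : Finset (Fin k)), f e.1 =
      ∏ y ∈ level k (n + 1), f y.dropLast := by
    refine Finset.prod_bij (fun e _ => e.1 ++ [e.2]) ?_ ?_ ?_ ?_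
    · intro e he
      have := mem_level.1 (Finset.mem_product.1 he).1
      rw [mem_level, List.length_append, this, List.length_singleton]
    · intro e _ e' _ hee
      have := List.append_inj' hee rfl
      exact Prod.ext this.1 (by simpa using this.2)
    · intro y hy
      have hl := mem_level.1 hy
      have hne : y ≠ [] := by rintro rfl; simp at hl
      refine ⟨(y.dropLast, y.getLast hne), Finset.mem_product.2 ⟨?_, Finset.mem_univ _⟩,
        List.dropLast_append_getLast _⟩
      rw [mem_level, List.length_dropLast, hl, Nat.add_sub_cancel]
    · intro e _
      simp
  rw [← h, Finset.prod_product]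
  simp

theorem ball_succ_erase (n : ℕ) :
    (ball k (n + 1)).erase [] = (ball k n).erase [] ∪ level k (n + 1) := by
  ext x
  simp only [Finset.mem_erase, Finset.mem_union, mem_ball, mem_level]
  constructor
  · rintro ⟨h, h'⟩
    by_cases hx : x.length ≤ n
    · exact Or.inl ⟨h, hx⟩
    · right; omega
  · rintro (⟨h, h'⟩ | h)
    · exact ⟨h, by omega⟩
    · exact ⟨by rintro rfl; simp at h, h.le⟩

theorem disjoint_ball_level_succ (n : ℕ) : Disjoint ((ball k n).erase []) (level k (n + 1)) :=
  Finset.disjoint_left.2 fun _ hx hx' =>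
    not_mem_ball_of_mem_level_succ hx' (Finset.mem_of_mem_erase hx)

/-- The Boltzmann weight in product form. -/
theorem weight_restrictBall (hp : 2 < p) {J : ℚ_[p]} (hJ : ‖J‖ < 1) {h : BoundaryFunction p k q}
    (hh : ∀ x i, ‖h x i‖ < 1) (n : ℕ) (ω : Config k q) :
    weight J h (restrictBall n ω) =
      (∏ y ∈ (ball k n).erase [], if ω y.dropLast = ω y then padicExp J else 1) *
        ∏ x ∈ level k n, padicExp (h x (ω x)) := by
  have h1 : (1 : ℝ) < p := by exact_mod_cast (by omega : 1 < p)
  have hsum : ∀ {ι : Type} (s : Finset ι) (f : ι → ℚ_[p]), (∀ i ∈ s, ‖f i‖ < 1) →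
      ‖∑ i ∈ s, f i‖ < 1 := fun s f hf =>
    (IsUltrametricDist.norm_sum_le_of_forall_le_of_nonneg (C := (p : ℝ)⁻¹) (by positivity)
      fun i hi => norm_le_inv_of_norm_lt_one (hf i hi)).trans_lt (inv_lt_one_of_one_lt₀ h1)
  have hterm : ∀ e ∈ edges k n,
      ‖if ω (e.1 : Vertex k) = ω (e.2 : Vertex k) then J else 0‖ < 1 := by
    intro e _
    split_ifs
    · exact hJ
    · simp
  have hham : hamiltonian J (restrictBall n ω) =
      ∑ e ∈ edges k n, if ω (e.1 : Vertex k) = ω (e.2 : Vertex k) then J else 0 := by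
    rw [hamiltonian, Finset.mul_sum]
    refine Finset.sum_congr rfl fun e _ => ?_
    rw [mul_ite, mul_one, mul_zero]
    rfl
  have hlev : ∑ x ∈ Finset.univ.filter (fun x : ball k n => (x : Vertex k) ∈ level k n),
      h x (restrictBall n ω x) = ∑ x ∈ level k n, h x (ω x) := by
    refine Finset.sum_bij (fun x _ => (x : Vertex k)) (fun x hx => (Finset.mem_filter.1 hx).2)
      (fun x _ y _ => Subtype.ext) (fun y hy => ⟨⟨y, level_subset_ball n hy⟩, by simpa using hy, rfl⟩)
      fun x _ => rfl
  rw [weight, hham, hlev, padicExp_add hp (hsum _ _ hterm) (hsum _ _ fun x _ => hh x _),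
    padicExp_sum hp _ _ hterm, padicExp_sum hp _ _ fun x _ => hh x _,
    ← prod_edges n fun x y => if ω x = ω y then padicExp J else 1]
  congr 1
  refine Finset.prod_congr rfl fun e _ => ?_
  split_ifs
  · rfl
  · exact padicExp_zero

/-- The configuration `ω` with its values on `W_n` replaced by `τ`. -/
def replaceLevel {n : ℕ} (ω : Config k q) (τ : LevelConfig k q n) : Config k q := fun v =>
  if h : v ∈ level k n then τ ⟨v, h⟩ else ω v

theorem concat_restrictBall {n : ℕ} (ω : Config k q) (τ : LevelConfig k q (n + 1)) :
    concat (restrictBall n ω) τ = restrictBall (n + 1) (replaceLevel ω τ) := by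
  ext v
  by_cases h : (v : Vertex k) ∈ ball k n
  · have h' : (v : Vertex k) ∉ level k (n + 1) := fun h' => not_mem_ball_of_mem_level_succ h' h
    simp [concat, restrictBall, replaceLevel, h, h']
  · have h' := mem_level_of_mem_ball_succ v.2 h
    simp [concat, restrictBall, replaceLevel, h, h']

/-- With the inner spins fixed, the vertices of W_{n+1} are independent, so the sum of products is a
product of sums over single spins. -/
theorem sum_weight_concat (hp : 2 < p) {J : ℚ_[p]} (hJ : ‖J‖ < 1) {h : BoundaryFunction p k q}
    (hh : ∀ x i, ‖h x i‖ < 1) (n : ℕ) (ω : Config k q) :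
    ∑ τ : LevelConfig k q (n + 1), weight J h (concat (restrictBall n ω) τ) =
      (∏ y ∈ (ball k n).erase [], if ω y.dropLast = ω y then padicExp J else 1) *
        ∏ y ∈ level k (n + 1),
          ∑ i, (if ω y.dropLast = i then padicExp J else 1) * padicExp (h y i) := by
  have hterm : ∀ τ : LevelConfig k q (n + 1), weight J h (concat (restrictBall n ω) τ) =
      (∏ y ∈ (ball k n).erase [], if ω y.dropLast = ω y then padicExp J else 1) *
        ∏ y : level k (n + 1), (if ω (y : Vertex k).dropLast = τ y then padicExp J else 1) *
          padicExp (h y (τ y)) := by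
    intro τ
    have hb : ∀ y ∈ ball k n, replaceLevel ω τ y = ω y := fun y hy =>
      dif_neg fun h' => not_mem_ball_of_mem_level_succ h' hy
    have hl : ∀ y : level k (n + 1), replaceLevel ω τ y = τ y := fun y => dif_pos y.2
    rw [concat_restrictBall, weight_restrictBall hp hJ hh, ball_succ_erase,
      Finset.prod_union (disjoint_ball_level_succ n), mul_assoc, ← Finset.prod_mul_distrib]
    congr 1
    · refine Finset.prod_congr rfl fun y hy => ?_
      have hy' := Finset.mem_of_mem_erase hy
      rw [hb y hy', hb]
      rw [mem_ball, List.length_dropLast]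
      have := mem_ball.1 hy'
      omega
    · rw [← Finset.prod_coe_sort]
      refine Finset.prod_congr rfl fun y _ => ?_
      rw [hl, hb]
      have := mem_level.1 y.2
      rw [mem_ball, List.length_dropLast]
      omega
  simp only [hterm]
  rw [← Finset.mul_sum, ← Finset.prod_coe_sort (level k (n + 1)), Fintype.prod_sum]

/-- If the weights satisfy the consistency equation up to a factor at each level, then the finite
volume distributions are well defined and compatible. -/
theorem compatible_of_sum_weight {J : ℚ_[p]} {h : BoundaryFunction p k q}
    (h0 : partitionFunction J h 0 ≠ 0)
    (hc : ∀ n, ∃ c : ℚ_[p], c ≠ 0 ∧ ∀ σ : VolConfig k q n,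
      ∑ τ : LevelConfig k q (n + 1), weight J h (concat σ τ) = c * weight J h σ) :
    (∀ n, partitionFunction J h n ≠ 0) ∧ Compatible J h := by
  have hZ : ∀ n, ∀ c : ℚ_[p], (∀ σ : VolConfig k q n,
      ∑ τ : LevelConfig k q (n + 1), weight J h (concat σ τ) = c * weight J h σ) →
      partitionFunction J h (n + 1) = c * partitionFunction J h n := by
    intro n c hcn
    rw [partitionFunction, sum_volConfig_succ, partitionFunction, Finset.mul_sum]
    exact Finset.sum_congr rfl fun σ _ => hcn σ
  refine ⟨fun n => ?_, fun n σ => ?_⟩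
  · induction n with
    | zero => exact h0
    | succ n ih =>
      obtain ⟨c, hc0, hcn⟩ := hc n
      rw [hZ n c hcn]
      exact mul_ne_zero hc0 ih
  · obtain ⟨c, hc0, hcn⟩ := hc n
    simp only [finiteGibbs]
    rw [← Finset.sum_div, hcn, hZ n c hcn, mul_div_mul_left _ _ hc0]

theorem partitionFunction_zero (hp : 2 < p) {J : ℚ_[p]} (hJ : ‖J‖ < 1)
    {h : BoundaryFunction p k q} (hh : ∀ x i, ‖h x i‖ < 1) :
    partitionFunction J h 0 = ∑ i, padicExp (h [] i) := by
  have hball : ball k 0 = {[]} := by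
    ext x
    simp [mem_ball]
  have hlevel : level k 0 = {[]} := by
    ext x
    simp [mem_level]
  have hmem : ([] : Vertex k) ∈ ball k 0 := by simp [hball]
  have hun : ∀ v : ball k 0, v = ⟨[], hmem⟩ := fun v => Subtype.ext (by simpa [hball] using v.2)
  have hval : ∀ i : Fin q, weight J h (restrictBall 0 fun _ => i) = padicExp (h [] i) := fun i => by
    rw [weight_restrictBall hp hJ hh, hball, hlevel]
    simp
  refine Finset.sum_bij' (fun σ _ => σ ⟨[], hmem⟩) (fun i _ => fun _ => i) (by simp) (by simp)
    (fun σ _ => funext fun v => by rw [hun v]) (by simp) fun σ _ => ?_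
  have hσ : σ = restrictBall 0 fun _ => σ ⟨[], hmem⟩ := funext fun v => by
    rw [hun v, restrictBall]
  conv_lhs => rw [hσ]
  exact hval _

theorem exists_unique_gibbsMeasure (d : Fin q) {J : ℚ_[p]} {h : BoundaryFunction p k q}
    (hh : ∀ x i, ‖h x i‖ < expRadius p) (hZ : ∀ n, partitionFunction J h n ≠ 0)
    (hc : Compatible J h) :
    ∃ μ : PadicMeasure p k q, IsGibbsMeasure J h μ ∧
      ∀ ν : PadicMeasure p k q, IsGibbsMeasure J h ν →
        ∀ A ∈ MeasureTheory.measurableCylinders (fun _ : Vertex k => Fin q), ν A = μ A := by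
  have hF : CompatibleFamily fun n (σ : VolConfig k q n) => finiteGibbs J h σ := hc
  refine ⟨cylinderContent hF d, ⟨hh, hZ, hc, fun n σ => cylinderContent_cylinder hF d σ⟩,
    fun ν hν A hA => padicMeasure_ext d (fun n σ => ?_) hA⟩
  rw [hν.extends_finite, cylinderContent_cylinder]

/-- A sequence `z` that is a backward orbit of the Potts–Bethe mapping of the tree defines a Gibbs
measure. -/
theorem gibbs_of_backward_orbit (hp : 2 < p) (d : Fin q) {J θ : ℚ_[p]} (hJ : ‖J‖ < 1)
    (hθ : θ = padicExp J) {a : ℕ} (P : Fin q → Prop) [DecidablePred P]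
    (hP : (Finset.univ.filter P).card = a) {z : ℕ → ℚ_[p]} (hz : ∀ n, ‖z n - 1‖ < 1)
    (hstep : ∀ n, pottsBetheDen θ a q (z (n + 1)) ≠ 0 ∧ z n = pottsBethe θ a q k (z (n + 1)))
    (h0 : (a : ℚ_[p]) * (z 0 - 1) + q ≠ 0) {h : ℚ_[p]} (hh : ‖h - 1‖ < 1)
    {H : BoundaryFunction p k q}
    (hH : ∀ x i, H x i = padicLog (h * if P i then z x.length else 1)) :
    ∃ μ : PadicMeasure p k q, IsGibbsMeasure J H μ ∧
      ∀ ν : PadicMeasure p k q, IsGibbsMeasure J H ν →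
        ∀ A ∈ MeasureTheory.measurableCylinders (fun _ : Vertex k => Fin q), ν A = μ A := by
  have hne : h ≠ 0 := norm_ne_zero_iff.1 (by rw [norm_eq_one_of_norm_sub_one_lt hh]; norm_num)
  have hdom : ∀ n i, ‖h * (if P i then z n else 1) - 1‖ < 1 := by
    intro n i
    refine norm_mul_sub_one_lt hh ?_
    split_ifs
    · exact hz n
    · simp
  have hHn : ∀ x i, ‖H x i‖ < 1 := fun x i => by
    rw [hH]
    exact norm_padicLog_lt_one hp (hdom _ _)
  have hexp : ∀ x i, padicExp (H x i) = h * if P i then z x.length else 1 := fun x i => by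
    rw [hH]
    exact padicExp_padicLog hp (hdom _ _)
  have hsum : ∀ w : ℚ_[p], ∑ i : Fin q, h * (if P i then w else 1) = h * (a * (w - 1) + q) := by
    intro w
    have : ∀ i, (if P i then w else 1) = (if P i then w - 1 else 0) + 1 := fun i => by
      split_ifs <;> ring
    rw [← Finset.mul_sum]
    simp only [this, Finset.sum_add_distrib, ← Finset.sum_filter, Finset.sum_const, hP]
    simp
  have hloc : ∀ (w : ℚ_[p]) (s : Fin q),
      ∑ i : Fin q, (if s = i then θ else 1) * (h * (if P i then w else 1)) =
        h * ((θ - 1) * (if P s then w else 1) + (a * (w - 1) + q)) := by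
    intro w s
    have : ∀ i, (if s = i then θ else 1) * (h * (if P i then w else 1)) =
        (if s = i then (θ - 1) * (h * (if P i then w else 1)) else 0) +
          h * (if P i then w else 1) := fun i => by
      split_ifs <;> ring
    simp only [this, Finset.sum_add_distrib, hsum, Finset.sum_ite_eq, Finset.mem_univ, if_true]
    ring
  -- For s in P the bracket is the numerator of the Potts–Bethe quotient, otherwise its denominator.
  -- The orbit equation turns the k-th power of their ratio into z n.
  have hpow : ∀ n s, (h * ((θ - 1) * (if P s then z (n + 1) else 1) +
      (a * (z (n + 1) - 1) + q))) ^ k =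
      h ^ k * pottsBetheDen θ a q (z (n + 1)) ^ k * (if P s then z n else 1) := by
    intro n s
    obtain ⟨hD, hzn⟩ := hstep n
    by_cases hs : P s
    · simp only [hs, if_true]
      rw [hzn, pottsBethe, div_pow, mul_div_assoc', eq_div_iff (pow_ne_zero _ hD), mul_pow]
      ring_nf
    · simp only [hs, if_false, mul_one]
      rw [← mul_pow, pottsBetheDen]
      ring_nf
  have hcomp := compatible_of_sum_weight (J := J) (h := H) ?_ fun n => ?_
  · exact exists_unique_gibbsMeasure d (fun x i => (norm_lt_expRadius_iff hp).2 (hHn x i))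
      hcomp.1 hcomp.2
  · rw [partitionFunction_zero hp hJ hHn]
    simp only [hexp, List.length_nil]
    rw [hsum]
    exact mul_ne_zero hne h0
  -- The k successors of each vertex of W_n contribute (h · den)^k times z n or 1, while the weight
  -- on V_n carries h times that same z n or 1. The ratio is one constant per vertex.
  · refine ⟨(h ^ k * pottsBetheDen θ a q (z (n + 1)) ^ k / h) ^ (level k n).card,
      pow_ne_zero _ (div_ne_zero (mul_ne_zero (pow_ne_zero _ hne)
        (pow_ne_zero _ (hstep n).1)) hne), fun σ => ?_⟩
    rw [← restrictBall_extendConst d σ]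
    generalize extendConst d σ = ω
    rw [sum_weight_concat hp hJ hHn, weight_restrictBall hp hJ hHn, mul_left_comm]
    congr 1
    rw [← Finset.prod_const, ← Finset.prod_mul_distrib]
    have hlev : ∀ y ∈ level k (n + 1),
        ∑ i, (if ω y.dropLast = i then padicExp J else 1) * padicExp (H y i) =
          h * ((θ - 1) * (if P (ω y.dropLast) then z (n + 1) else 1) +
            (a * (z (n + 1) - 1) + q)) := by
      intro y hy
      simp only [hexp, ← hθ]
      rw [mem_level.1 hy, hloc]
    rw [Finset.prod_congr rfl hlev, prod_level_succ n fun x =>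
      h * ((θ - 1) * (if P (ω x) then z (n + 1) else 1) + (a * (z (n + 1) - 1) + q))]
    refine Finset.prod_congr rfl fun x hx => ?_
    rw [hpow, hexp, mem_level.1 hx]
    field_simp

end Weights

/-! ### The arithmetic condition on |α|, and the vectors of the statement. -/

section Main

variable {p : ℕ} [Fact p.Prime]

/-- A natural number `0 < a < q` that is not a multiple of `1 / |q|_p` satisfies
`|q|_p < |a|_p`. -/
theorem norm_lt_norm_of_not_multiple {q qs a : ℕ} (hqs : (q : ℝ) = (qs : ℝ) / ‖(q : ℚ_[p])‖)
    (ha0 : 0 < a) (haq : a < q)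
    (h : ∀ i : ℕ, 1 ≤ i → i ≤ qs - 1 → (a : ℝ) ≠ (i : ℝ) / ‖(q : ℚ_[p])‖) :
    ‖(q : ℚ_[p])‖ < ‖(a : ℚ_[p])‖ := by
  by_contra hle
  rw [not_lt] at hle
  have hq0 : (q : ℚ_[p]) ≠ 0 := by exact_mod_cast (by omega : q ≠ 0)
  have hpos : 0 < ‖(q : ℚ_[p])‖ := norm_pos_iff.2 hq0
  have hnorm : ‖(q : ℚ_[p])‖ = ((p : ℝ) ^ padicValNat p q)⁻¹ := by
    rw [Padic.norm_eq_zpow_neg_valuation hq0, Padic.valuation_natCast, zpow_neg, zpow_natCast]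
  -- Since 1/|q|_p = p^v with v = v_p(q), |a| ≤ |q| means that p^v divides a; the quotient i then
  -- satisfies 0 < i < qs, an excluded case.
  have hdvd : p ^ padicValNat p q ∣ a := by
    have := (Padic.norm_int_le_pow_iff_dvd (p := p) (a : ℤ) (padicValNat p q)).1 (by
      rw [zpow_neg, zpow_natCast, ← hnorm]
      exact_mod_cast hle)
    exact_mod_cast this
  obtain ⟨i, hi⟩ := hdvd
  have hai : (a : ℝ) = (i : ℝ) / ‖(q : ℚ_[p])‖ := by
    rw [hnorm, div_inv_eq_mul, mul_comm, hi]
    push_cast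
    rfl
  have hi0 : i ≠ 0 := by rintro rfl; simp at hi; omega
  have hlt : (i : ℝ) < qs := by
    have : (a : ℝ) < q := by exact_mod_cast haq
    rw [hai, hqs] at this
    exact (div_lt_div_iff_of_pos_right hpos).1 this
  have hlt' : i < qs := by exact_mod_cast hlt
  exact h i (by omega) (by omega) hai

theorem indicatorVec_apply {q : ℕ} (s : Finset (Fin (q - 1))) (i : Fin (q - 1)) :
    (indicatorVec s : Fin (q - 1) → ℚ_[p]) i = if i ∈ s then 1 else 0 := by
  rw [indicatorVec, Finset.sum_apply]
  simp [Pi.single_apply]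

/-- The spin `i` belongs to `α`, regarded as a set of spins in `Fin q`. -/
def SpinMem {q : ℕ} (α : Finset (Fin (q - 1))) (i : Fin q) : Prop :=
  ∃ hi : (i : ℕ) < q - 1, (⟨i, hi⟩ : Fin (q - 1)) ∈ α

open Classical in
theorem card_spinMem {q : ℕ} (α : Finset (Fin (q - 1))) :
    (Finset.univ.filter (SpinMem α)).card = α.card := by
  refine (Finset.card_bij (fun (j : Fin (q - 1)) _ => (⟨j, lt_of_lt_of_le j.2 (Nat.sub_le q 1)⟩ : Fin q)) ?_ ?_ ?_).symm
  · intro j hj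
    exact Finset.mem_filter.2 ⟨Finset.mem_univ _, j.2, hj⟩
  · intro j _ j' _ hjj
    exact Fin.ext (by simpa using hjj)
  · intro i hi
    obtain ⟨hi', h⟩ := (Finset.mem_filter.1 hi).2
    exact ⟨_, h, rfl⟩

open Classical in
theorem logVec_apply {q : ℕ} {α β : Finset (Fin (q - 1))} (hαβ : Disjoint α β)
    (hcard : α.card + β.card = q - 1) (h z : ℚ_[p]) (i : Fin q) :
    logVec h (z • indicatorVec α + indicatorVec β) i =
      padicLog (h * if SpinMem α i then z else 1) := by
  have huniv : ∀ j, j ∈ α ∨ j ∈ β := by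
    intro j
    have : α ∪ β = Finset.univ := by
      rw [← Finset.card_eq_iff_eq_univ, Finset.card_union_of_disjoint hαβ, hcard, Fintype.card_fin]
    exact Finset.mem_union.1 (this ▸ Finset.mem_univ j)
  rw [logVec]
  by_cases hi : (i : ℕ) < q - 1
  · rw [dif_pos hi, Pi.add_apply, Pi.smul_apply, indicatorVec_apply, indicatorVec_apply]
    by_cases hα : (⟨i, hi⟩ : Fin (q - 1)) ∈ α
    · have hβ := Finset.disjoint_left.1 hαβ hα
      rw [if_pos hα, if_neg hβ, if_pos ⟨hi, hα⟩]
      simp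
    · have hβ := (huniv ⟨i, hi⟩).resolve_left hα
      rw [if_neg hα, if_pos hβ, if_neg fun ⟨_, h⟩ => hα h]
      simp
  · rw [dif_neg hi, if_neg fun ⟨h, _⟩ => hi h, mul_one]

end Main

end

end PadicPotts

open PadicPotts
theorem mainTheorem2 (p q qs m : ℕ) [Fact p.Prime] [NeZero m] (hp : p ≡ 1 [MOD 3])
    (J θ : ℚ_[p]) (hJ : ‖J‖ < expRadius p) (hθ : θ = padicExp J)
    (hθ₁ : 0 < ‖θ - 1‖) (hθq : ‖θ - 1‖ < ‖(q : ℚ_[p])‖) (hq : ‖(q : ℚ_[p])‖ < 1)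
    (hqs : (q : ℝ) = (qs : ℝ) / ‖(q : ℚ_[p])‖) (hpqs : ¬ p ∣ qs)
    (α β : Finset (Fin (q - 1))) (hαβ : Disjoint α β) (hcard : α.card + β.card = q - 1)
    (hα : α.Nonempty)
    (hαq : ∀ i : ℕ, 1 ≤ i → i ≤ qs - 1 → (α.card : ℝ) ≠ (i : ℝ) / ‖(q : ℚ_[p])‖) :
    (∃ z : Fin m → ℚ_[p], IsPottsBetheCycle θ α.card q 3 z ∧
      Function.Injective z ∧ ∀ j, z j ≠ 1) ∧
    (∀ z : Fin m → ℚ_[p], IsPottsBetheCycle θ α.card q 3 z →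
      (∀ j, z j ∈ expDomain p) ∧
      ∀ h ∈ expDomain p, ∃ H : BoundaryFunction p 3 q,
        IsPeriodicBoundary (fun j => logVec h (z j • indicatorVec α + indicatorVec β)) H ∧
        ∃ μ : PadicMeasure p 3 q, IsGibbsMeasure J H μ ∧
          ∀ ν : PadicMeasure p 3 q, IsGibbsMeasure J H ν →
            ∀ A ∈ MeasureTheory.measurableCylinders (fun _ : Vertex 3 => Fin q), ν A = μ A) := by
  classical
  have hprime : p.Prime := Fact.out
  have hp3 : 3 < p := by
    have h2 := hprime.two_le
    have h3 : p % 3 = 1 := hp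
    have : p ≠ 2 := by rintro rfl; omega
    have : p ≠ 3 := by rintro rfl; omega
    omega
  have hp2 : 2 < p := by omega
  have ha0 : 0 < α.card := hα.card_pos
  have haq : α.card < q := by omega
  have hqa := norm_lt_norm_of_not_multiple hqs ha0 haq hαq
  have hm : 0 < m := NeZero.pos m
  refine ⟨?_, fun z hz => ?_⟩
  · obtain ⟨z, hz, hinj, hz1⟩ := exists_injective_cycle hp hp3 hθ₁ hθq hqa m
    refine ⟨z, fun j => ?_, hinj, hz1⟩
    have hD : ∀ j, pottsBetheDen θ α.card q (z j) ≠ 0 := fun j => by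
      rw [pottsBetheDen_eq]
      exact (hz j).1
    exact ⟨hD j, by rw [pottsBethe_eq 3 (hD _), (hz j).2]⟩
  -- The cycle is unrolled into an m-periodic sequence on ℕ, so that a vertex at depth n carries the
  -- point of index n mod m.
  · have hstep : ∀ n : ℕ, z (Fin.ofNat m n) - 1 =
        (1 + (θ - 1) * (z (Fin.ofNat m (n + 1)) - 1) /
          (α.card * (z (Fin.ofNat m (n + 1)) - 1) + q + (θ - 1))) ^ 3 - 1 := fun n => by
      rw [ofNat_succ_eq, ← pottsBethe_eq 3 (hz _).1, ← (hz _).2]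
    have hper : ∀ n : ℕ, z (Fin.ofNat m (n + m)) - 1 = z (Fin.ofNat m n) - 1 := fun n => by
      congr 2
      ext
      simp
    have hofNat : ∀ (n : ℕ) (j : Fin m), n ≡ j [MOD m] → Fin.ofNat m n = j := fun n j hnj =>
      Fin.ext (Eq.trans hnj (Nat.mod_eq_of_lt j.2))
    have hlt := cycle_norm_lt_one (U := fun n => z (Fin.ofNat m n) - 1) hp3 hθq hqa hm hper hstep
    refine ⟨fun j => ?_, fun h hh => ?_⟩
    · rw [mem_expDomain_iff hp2, ← hofNat j j rfl]
      exact hlt j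
    · refine ⟨fun x => logVec h (z (Fin.ofNat m x.length) • indicatorVec α + indicatorVec β),
        fun x j hxj => by simp only [hofNat _ j hxj], ?_⟩
      refine gibbs_of_backward_orbit (z := fun n => z (Fin.ofNat m n)) hp2
        (⟨0, by omega⟩ : Fin q) ((norm_lt_expRadius_iff hp2).1 hJ) hθ (SpinMem α) (card_spinMem α)
        hlt (fun n => ?_) ?_ ((mem_expDomain_iff hp2).1 hh)
        fun x i => logVec_apply hαβ hcard h _ i
      · simp only [ofNat_succ_eq]
        exact ⟨(hz _).1, (hz _).2⟩
      · exact cycle_add_ne_zero (U := fun n => z (Fin.ofNat m n) - 1) hp3 hθ₁ hθq hqa hm hper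
          hstep 0
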